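/- Let $U\subseteq\mathbb C^2$ be a nonempty open set with coordinates $(x,y)$, let $\mathfrak D$ be the algebra of differential operators $T=\sum_{i,j} f_{ij}\,\partial_x^i\partial_y^j$ (finite sums) with $f_{ij}\in C^\infty(U,\mathbb C)$, acting on $C^\infty(U,\mathbb C)$ (with $\partial_x,\partial_y$ the derivatives with respect to the complex coordinates), and let $\mathfrak D^{(k)}$ be the operators of order at most $k$. Let $r\ge 2$ and $p,q\ge 0$ be integers and $$\mathcal S=\mathcal S^r_{p,q}=\operatorname{span}\{x^iy^j : i,j\ge 0,\ i+rj\le p,\ j\le q\}.$$ Let $\mathfrak S\subset\mathfrak D$ be the operators that map $\mathcal S$ into itself, $\ker\pi\subset\mathfrak S$ the kernel of the restriction map $\pi:\mathfrak S\to\operatorname{End}(\mathcal S)$, and $$\tilde{\mathfrak S}=\Big\{T\in\mathfrak S : T=\sum_{i+rj\le p,\ j\le q} f_{ij}\,\partial_x^i\partial_y^j\Big\}.$$ An operator $T$ with polynomial coefficients has bidegree $(a,b)\in\mathbb Z^2$ if $T(x^iy^j)\in\langle x^{i+a}y^{j+b}\rangle$ for all $i,j\ge0$ (to be read as $T(x^iy^j)=0$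 if $i+a<0$ or $j+b<0$); $b$ is its $y$-degree. Let $\tilde{\mathfrak S}^{\downarrow}$ be the set of $T\in\tilde{\mathfrak S}$ that are sums of operators of nonpositive $y$-degree. Let $\mathfrak g^{24,r}_p$ be the Lie algebra spanned by the $r+5$ generators $$J^1=\partial_x,\quad J^2=x^2\partial_x+rxy\,\partial_y-px,\quad J^3=x\partial_x-\tfrac p2,\quad J^4=y\partial_y,\quad J^{5+i}=x^i\partial_y\ (0\le i\le r).$$ A polynomial of degree at most $k$ in the generators is a linear combination of ordered monomials $(J^1)^{K_1}\cdots(J^{5+r})^{K_{5+r}}$ with $K_1+\dots+K_{5+r}\le k$. Then $\mathfrak S=\tilde{\mathfrak S}\oplus\ker\pi$, and the following hold. 1. If $T\in\tilde{\mathfrak S}^{\downarrow}\cap\mathfrak D^{(k)}$ with $k\le q$ and $rk\le p$ (the latter follows from $k\le q$ if, as usual, $rq\le p$), then $T$ is a polynomial of degree at most $k$ in the generators of $\mathfrak g^{24,r}_p$. 2. If $T\in\tilde{\mathfrak S}^{\downarrow}\cap\mathfrak D^{(k)}$ with $k$ arbitrary (in particular if $k>q$), then $T$ is the projection onto $\tilde{\mathfrak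 S}$ along $\ker\pi$ of a polynomial of degree at most $k$ in the generators of $\mathfrak g^{24,r}_p$. In both cases, if $T$ has order exactly $k$, the polynomial has degree exactly $k$. 3. No $T\in\tilde{\mathfrak S}\setminus\tilde{\mathfrak S}^{\downarrow}$, and no nonzero $T\in\tilde{\mathfrak S}$ having a bidegree with positive $y$-degree, is the sum of a polynomial in the generators of $\mathfrak g^{24,r}_p$ (of any degree, factors in any order) and an operator in $\ker\pi$. For example, if $r=2$, $p\ge2$ and $q=\lfloor p/2\rfloor$, then $y\partial_x^2$ lies in $\tilde{\mathfrak S}$, has bidegree $(-2,1)$, and is not such a sum. -/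

import Mathlib

open TopologicalSpace
open scoped ContDiff

noncomputable section

namespace Staircase

/-- Extension by zero of a function on `U`; only its restriction to `U` matters. -/
def extZero (U : Opens (ℂ × ℂ)) (f : U → ℂ) : ℂ × ℂ → ℂ :=
  open Classical in fun z => if h : z ∈ U then f ⟨z, h⟩ else 0

theorem extZero_apply (U : Opens (ℂ × ℂ)) (f : U → ℂ) {z : ℂ × ℂ} (h : z ∈ U) :
    extZero U f z = f ⟨z, h⟩ := by
  simp [extZero, h]

/-- The algebra `C^∞(U, ℂ)` of (real-)smooth complex-valued functions on `U ⊆ ℂ²`. -/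
def Smooth (U : Opens (ℂ × ℂ)) : Subalgebra ℂ (U → ℂ) where
  carrier := {f | ContDiffOn ℝ ∞ (extZero U f) U}
  mul_mem' {f g} hf hg := by
    refine ContDiffOn.congr (ContDiffOn.mul hf hg) fun z hz => ?_
    have hz' : z ∈ U := hz
    simp [extZero_apply U _ hz']
  add_mem' {f g} hf hg := by
    refine ContDiffOn.congr (ContDiffOn.add hf hg) fun z hz => ?_
    have hz' : z ∈ U := hz
    simp [extZero_apply U _ hz']
  algebraMap_mem' c := by
    refine ContDiffOn.congr (contDiffOn_const (c := c)) fun z hz => ?_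
    have hz' : z ∈ U := hz
    simp [extZero_apply U _ hz']

/-- The derivative `(D_v g - i D_{iv} g) / 2`.  For `v = (1,0)` and `v = (0,1)` these are the
operators `∂/∂x` and `∂/∂y` of the complex coordinates `x, y` on smooth functions; on holomorphic
functions they are the complex partial derivatives. -/
def wirtinger (v : ℂ × ℂ) (g : ℂ × ℂ → ℂ) (z : ℂ × ℂ) : ℂ :=
  (fderiv ℝ g z v - Complex.I * fderiv ℝ g z (Complex.I • v)) / 2

theorem differentiableAt_extZero {U : Opens (ℂ × ℂ)} (f : Smooth U) {z : ℂ × ℂ} (hz : z ∈ U) :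
    DifferentiableAt ℝ (extZero U f) z :=
  ((f.2 : ContDiffOn ℝ ∞ (extZero U f) U).contDiffAt (U.isOpen.mem_nhds hz)).differentiableAt
    (by simp)

theorem contDiffOn_wirtinger {U : Opens (ℂ × ℂ)} (v : ℂ × ℂ) (f : Smooth U) :
    ContDiffOn ℝ ∞ (wirtinger v (extZero U f)) U := by
  have h : ContDiffOn ℝ ∞ (fderiv ℝ (extZero U f)) U :=
    ContDiffOn.fderiv_of_isOpen f.2 U.isOpen (by simp)
  have h1 := h.clm_apply (contDiffOn_const (c := v))
  have h2 := h.clm_apply (contDiffOn_const (c := Complex.I • v))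
  exact (h1.sub (contDiffOn_const.mul h2)).div_const 2

theorem extZero_add {U : Opens (ℂ × ℂ)} (f g : U → ℂ) :
    extZero U (f + g) = extZero U f + extZero U g := by
  funext z
  by_cases h : z ∈ U <;> simp [extZero, h]

theorem extZero_smul {U : Opens (ℂ × ℂ)} (c : ℂ) (f : U → ℂ) :
    extZero U (c • f) = c • extZero U f := by
  funext z
  by_cases h : z ∈ U <;> simp [extZero, h]

/-- The partial derivative in the complex direction `v`, as an operator on `C^∞(U, ℂ)`. -/
def partialD (U : Opens (ℂ × ℂ)) (v : ℂ × ℂ) : Module.End ℂ (Smooth U) where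
  toFun f := ⟨fun z => wirtinger v (extZero U f) z, by
    refine ContDiffOn.congr (contDiffOn_wirtinger v f) fun z hz => ?_
    have hz' : z ∈ U := hz
    simp [extZero_apply U _ hz']⟩
  map_add' f g := by
    ext z
    have hf := differentiableAt_extZero f z.2
    have hg := differentiableAt_extZero g z.2
    simp only [wirtinger, AddMemClass.coe_add, extZero_add, fderiv_add hf hg,
      add_apply, Pi.add_apply]
    ring
  map_smul' c f := by
    ext z
    have hf := differentiableAt_extZero f z.2
    simp only [wirtinger, SetLike.val_smul, extZero_smul, fderiv_const_smul hf c,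
      smul_apply, Pi.smul_apply, RingHom.id_apply, smul_eq_mul]
    ring

/-- `∂_x`. -/
def Dx (U : Opens (ℂ × ℂ)) : Module.End ℂ (Smooth U) := partialD U (1, 0)

/-- `∂_y`. -/
def Dy (U : Opens (ℂ × ℂ)) : Module.End ℂ (Smooth U) := partialD U (0, 1)

/-- The coordinate function `x`. -/
def X (U : Opens (ℂ × ℂ)) : Smooth U :=
  ⟨fun z => z.1.1, by
    refine ContDiffOn.congr (contDiff_fst (𝕜 := ℝ) (E := ℂ) (F := ℂ)).contDiffOn fun z hz => ?_
    have hz' : z ∈ U := hz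
    simp [extZero_apply U _ hz']⟩

/-- The coordinate function `y`. -/
def Y (U : Opens (ℂ × ℂ)) : Smooth U :=
  ⟨fun z => z.1.2, by
    refine ContDiffOn.congr (contDiff_snd (𝕜 := ℝ) (E := ℂ) (F := ℂ)).contDiffOn fun z hz => ?_
    have hz' : z ∈ U := hz
    simp [extZero_apply U _ hz']⟩

/-- Multiplication by a smooth function, as an operator. -/
abbrev mulOp {U : Opens (ℂ × ℂ)} (f : Smooth U) : Module.End ℂ (Smooth U) :=
  LinearMap.mulLeft ℂ f

/-- The operator `∑ f_{ij} ∂_x^i ∂_y^j` with coefficients `f_{ij}`, all but finitely many zero. -/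
def toOp (U : Opens (ℂ × ℂ)) : (ℕ × ℕ →₀ Smooth U) →ₗ[ℂ] Module.End ℂ (Smooth U) :=
  Finsupp.lsum ℂ fun ij =>
    (LinearMap.mulRight ℂ (Dx U ^ ij.1 * Dy U ^ ij.2)).comp (LinearMap.mul ℂ (Smooth U))

/-- The operators `∑_{(i,j) ∈ A} f_{ij} ∂_x^i ∂_y^j` with smooth coefficients. -/
def opsOn (U : Opens (ℂ × ℂ)) (A : Set (ℕ × ℕ)) : Submodule ℂ (Module.End ℂ (Smooth U)) :=
  (Finsupp.supported (Smooth U) ℂ A).map (toOp U)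

/-- All differential operators on `U` with smooth coefficients. -/
def diffOps (U : Opens (ℂ × ℂ)) : Submodule ℂ (Module.End ℂ (Smooth U)) :=
  opsOn U Set.univ

/-- The differential operators of order at most `k`. -/
def opsOfOrderLE (U : Opens (ℂ × ℂ)) (k : ℕ) : Submodule ℂ (Module.End ℂ (Smooth U)) :=
  opsOn U {ij | ij.1 + ij.2 ≤ k}

/-- `T` is a differential operator with polynomial coefficients. -/
def IsPolyOp {U : Opens (ℂ × ℂ)} (T : Module.End ℂ (Smooth U)) : Prop :=
  ∃ f : ℕ × ℕ →₀ Smooth U, (∀ ij, f ij ∈ Algebra.adjoin ℂ {X U, Y U}) ∧ toOp U f = T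

/-- `T` has polynomial coefficients and bidegree `(a, b)`: it maps every monomial
`x^i y^j` to a multiple of `x^(i+a) y^(j+b)` (to zero if an exponent is negative). -/
def HasBidegree {U : Opens (ℂ × ℂ)} (T : Module.End ℂ (Smooth U)) (a b : ℤ) : Prop :=
  IsPolyOp T ∧ ∀ i j : ℕ, T (X U ^ i * Y U ^ j) ∈
    Submodule.span ℂ {u : Smooth U | ∃ m n : ℕ, (m : ℤ) = i + a ∧ (n : ℤ) = j + b ∧
      u = X U ^ m * Y U ^ n}

/-- The exponents of the staircase. -/
def stairs (r p q : ℕ) : Set (ℕ × ℕ) := {ij | ij.1 + r * ij.2 ≤ p ∧ ij.2 ≤ q}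

/-- The staircase module `S^r_{p,q}`, as a space of functions on `U`. -/
def stairModule (U : Opens (ℂ × ℂ)) (r p q : ℕ) : Submodule ℂ (Smooth U) :=
  Submodule.span ℂ ((fun ij : ℕ × ℕ => X U ^ ij.1 * Y U ^ ij.2) '' stairs r p q)

/-- The differential operators that preserve `S^r_{p,q}`. -/
def preserving (U : Opens (ℂ × ℂ)) (r p q : ℕ) : Submodule ℂ (Module.End ℂ (Smooth U)) where
  carrier := {T | T ∈ diffOps U ∧ ∀ u ∈ stairModule U r p q, T u ∈ stairModule U r p q}
  add_mem' h h' := ⟨add_mem h.1 h'.1, fun u hu => add_mem (h.2 u hu) (h'.2 u hu)⟩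
  zero_mem' := ⟨zero_mem _, fun _ _ => zero_mem _⟩
  smul_mem' c _ h :=
    ⟨Submodule.smul_mem _ c h.1, fun u hu => Submodule.smul_mem _ c (h.2 u hu)⟩

/-- The kernel of the restriction homomorphism from the operators preserving `S^r_{p,q}` to
`End S^r_{p,q}`. -/
def kerRestrict (U : Opens (ℂ × ℂ)) (r p q : ℕ) : Submodule ℂ (Module.End ℂ (Smooth U)) where
  carrier := {T | T ∈ preserving U r p q ∧ ∀ u ∈ stairModule U r p q, T u = 0}
  add_mem' h h' := ⟨add_mem h.1 h'.1, fun u hu => by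
    rw [LinearMap.add_apply, h.2 u hu, h'.2 u hu, add_zero]⟩
  zero_mem' := ⟨zero_mem _, fun _ _ => rfl⟩
  smul_mem' c _ h := ⟨Submodule.smul_mem _ c h.1, fun u hu => by
    rw [LinearMap.smul_apply, h.2 u hu, smul_zero]⟩

/-- The distinguished complement: operators preserving `S^r_{p,q}` of the form
`∑ f_{ij} ∂_x^i ∂_y^j` over `i + r j ≤ p`, `j ≤ q`. -/
def complement (U : Opens (ℂ × ℂ)) (r p q : ℕ) : Submodule ℂ (Module.End ℂ (Smooth U)) :=
  preserving U r p q ⊓ opsOn U (stairs r p q)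

/-- The operators in the distinguished complement with nonpositive `y`-degree, i.e. that are
sums of operators of bidegrees `(a, b)` with `b ≤ 0`. -/
def complementDown (U : Opens (ℂ × ℂ)) (r p q : ℕ) : Submodule ℂ (Module.End ℂ (Smooth U)) :=
  complement U r p q ⊓
    Submodule.span ℂ {T | ∃ a b : ℤ, b ≤ 0 ∧ HasBidegree T a b}

/-- The generators `J^1, …, J^{5+r}`, numbered from `0`:
`∂_x`, `x²∂_x + r x y ∂_y - p x`, `x∂_x - p/2`, `y∂_y`, and `x^i ∂_y` for `0 ≤ i ≤ r`. -/
def genAux (U : Opens (ℂ × ℂ)) (r p : ℕ) : ℕ → Module.End ℂ (Smooth U)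
  | 0 => Dx U
  | 1 => mulOp (X U ^ 2) * Dx U + (r : ℂ) • (mulOp (X U * Y U) * Dy U) - (p : ℂ) • mulOp (X U)
  | 2 => mulOp (X U) * Dx U - ((p : ℂ) / 2) • 1
  | 3 => mulOp (Y U) * Dy U
  | i + 4 => mulOp (X U ^ i) * Dy U

/-- The `r + 5` generators. -/
def gen (U : Opens (ℂ × ℂ)) (r p : ℕ) (s : Fin (r + 5)) : Module.End ℂ (Smooth U) :=
  genAux U r p s

/-- The value of a polynomial at the generators: each monomial is evaluated as the ordered
product `(J^1)^{K_1} (J^2)^{K_2} ⋯ (J^{5+r})^{K_{5+r}}`. -/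
def evalGen (U : Opens (ℂ × ℂ)) (r p : ℕ) (P : MvPolynomial (Fin (r + 5)) ℂ) :
    Module.End ℂ (Smooth U) :=
  ∑ K ∈ P.support, P.coeff K • (List.ofFn fun s => gen U r p s ^ K s).prod

/-- `T` is the projection of `P` onto the distinguished complement along the kernel. -/
def IsProjection (U : Opens (ℂ × ℂ)) (r p q : ℕ) (P T : Module.End ℂ (Smooth U)) : Prop :=
  P ∈ preserving U r p q ∧ T ∈ complement U r p q ∧ P - T ∈ kerRestrict U r p q

/-- `T` is a polynomial in the generators, of any degree and with the factors in any order, plus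
an operator in the kernel. -/
def IsLieAlgebraic (U : Opens (ℂ × ℂ)) (r p q : ℕ) (T : Module.End ℂ (Smooth U)) : Prop :=
  ∃ P ∈ Algebra.adjoin ℂ (Set.range (gen U r p)), ∃ N ∈ kerRestrict U r p q, T = P + N

end Staircase

end

/-! The values of `∑ f_{ij} ∂_x^i ∂_y^j` on monomials determine the coefficients triangularly, and
the staircase is a lower set. Hence an operator with exponents in the staircase is determined by its
restriction to `𝒮`, the restriction to `𝒮` of any differential operator is that of such an operator,
and the coefficients are polynomials if `𝒮` is preserved.

An operator of `𝔖̃` is thus a sum of operators of bidegrees `(c, b)`, which preserve `𝒮` separately.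
If `b = -β ≤ 0`, such a component acts by `xⁱ yʲ ↦ σ(i, j) xⁱ⁺ᶜ yʲ⁻ᵝ` with a polynomial `σ`. Write
`c = a + d - α` with `0 ≤ a ≤ r β`, where `α > 0` only if `a = d = 0`, and `d > 0` only if
`a = r β`. Then `σ` is divisible by the falling factorials of `i` and `j` of lengths `α` and `β`.
Since `𝒮` is preserved, the quotient vanishes at the points with `j ≥ β` on the `d` diagonals
`p - d < i + r j ≤ p`, so that on the staircase it may be divided by the rising factorial of length
`d` of `i + r j - p`. These factors are produced by `∂_x^α`, by `β` factors `x^s ∂_y` with exponents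
`s` of sum `a`, and by `(J²)^d`; the remaining polynomial in `i` and `j` is one in the eigenvalues
of `J³` and `J⁴`. No step increases the order.

Conversely no generator raises the `y`-degree. -/

/-! ### Linear algebra and polynomials -/

section LinearIndependent

variable {ι δ R V : Type*} [Ring R] [AddCommGroup V] [Module R V] {v : ι → V}

theorem linearCombination_mem_span_image_iff (hv : LinearIndependent R v) {c : ι →₀ R}
    {S : Set ι} :
    Finsupp.linearCombination R v c ∈ Submodule.span R (v '' S) ↔ ↑c.support ⊆ S := by
  rw [Finsupp.mem_span_image_iff_linearCombination]
  constructor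
  · rintro ⟨d, hd, h⟩
    rwa [← hv h]
  · exact fun h => ⟨c, h, rfl⟩

theorem mem_span_image_of_sum_mem (hv : LinearIndependent R v) {F : δ → Set ι}
    (hF : Pairwise (Function.onFun Disjoint F)) {s : Finset δ} {u : δ → V} {S : Set ι}
    (hu : ∀ d, u d ∈ Submodule.span R (v '' F d))
    (hsum : ∑ d ∈ s, u d ∈ Submodule.span R (v '' S)) {d : δ} (hd : d ∈ s) :
    u d ∈ Submodule.span R (v '' S) := by
  simp only [Finsupp.mem_span_image_iff_linearCombination] at hu
  choose c hcF hc using hu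
  simp only [← hc] at hsum ⊢
  rw [← map_sum, linearCombination_mem_span_image_iff hv] at hsum
  rw [linearCombination_mem_span_image_iff hv]
  intro e he
  refine hsum ?_
  have hother : ∀ d' ∈ s, d' ≠ d → c d' e = 0 := fun d' _ hne => by
    by_contra h
    exact Set.disjoint_left.1 (hF hne) (hcF d' (Finsupp.mem_support_iff.2 h)) (hcF d he)
  rw [Finset.mem_coe, Finsupp.mem_support_iff, Finsupp.finsetSum_apply,
    Finset.sum_eq_single_of_mem d hd hother]
  exact Finsupp.mem_support_iff.1 he

end LinearIndependent

theorem pow_apply_of_apply_eq_smul {R M : Type*} [CommSemiring R] [AddCommMonoid M] [Module R M]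
    {T : Module.End R M} {c : R} {u : M} (h : T u = c • u) (n : ℕ) : (T ^ n) u = c ^ n • u := by
  induction n with
  | zero => simp
  | succ n ih => rw [pow_succ', Module.End.mul_apply, ih, map_smul, h, smul_smul, pow_succ]

theorem exists_sum_eq_sum_mul_eq {r a β : ℕ} (h : a ≤ r * β) :
    ∃ L : Fin (r + 1) → ℕ, ∑ s, L s = β ∧ ∑ s : Fin (r + 1), (s : ℕ) * L s = a := by
  induction β generalizing a with
  | zero => exact ⟨0, by simp, by simp; omega⟩
  | succ β ih =>
    obtain ⟨L, hL, hLa⟩ := ih (a := a - min a r) (by rw [Nat.mul_succ] at h; omega)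
    let s₀ : Fin (r + 1) := ⟨min a r, by omega⟩
    refine ⟨L + Pi.single s₀ 1, ?_, ?_⟩
    · simp [Finset.sum_add_distrib, hL]
    · have hs₀ : ∑ s : Fin (r + 1), (s : ℕ) * Pi.single (M := fun _ => ℕ) s₀ 1 s = min a r := by
        simp [Pi.single_apply, s₀]
      simp only [Pi.add_apply, mul_add, Finset.sum_add_distrib, hLa, hs₀]
      omega

theorem exists_shift_decomposition (r β : ℕ) (x : ℤ) :
    ∃ α d a : ℕ, (a + d - α : ℤ) = x ∧ a ≤ r * β ∧ (α = 0 ∨ a + d = 0) ∧ (d = 0 ∨ a = r * β) :=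
  ⟨(-x).toNat, (x - (r * β : ℕ)).toNat, min x.toNat (r * β), by omega⟩

section TotalDegree

open MvPolynomial

variable {σ τ R : Type*} [CommRing R]

theorem totalDegree_aeval_le {f : σ → MvPolynomial τ R} (hf : ∀ s, (f s).totalDegree ≤ 1)
    (F : MvPolynomial σ R) : (aeval f F).totalDegree ≤ F.totalDegree := by
  rw [aeval_def, eval₂_eq]
  refine totalDegree_finsetSum_le fun d hd => (totalDegree_mul _ _).trans ?_
  rw [algebraMap_eq, totalDegree_C, zero_add]
  refine (totalDegree_finsetProd _ _).trans (le_trans ?_ (le_totalDegree hd))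
  exact Finset.sum_le_sum fun s _ =>
    (totalDegree_pow _ _).trans ((Nat.mul_le_mul_left _ (hf s)).trans_eq (mul_one _))

theorem X_sub_dvd_sub_aeval_update [DecidableEq σ] (s : σ) (g F : MvPolynomial σ R) :
    X s - g ∣ F - aeval (Function.update X s g) F := by
  have hcomp : (Ideal.Quotient.mkₐ R (Ideal.span {X s - g})).comp
      (aeval (Function.update X s g)) = Ideal.Quotient.mkₐ R (Ideal.span {X s - g}) := by
    refine algHom_ext fun t => ?_
    rw [AlgHom.comp_apply, aeval_X]
    rcases eq_or_ne t s with rfl | hts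
    · rw [Function.update_self]
      exact (Ideal.Quotient.eq.2 (Ideal.mem_span_singleton_self _)).symm
    · rw [Function.update_of_ne hts]
  exact Ideal.mem_span_singleton.1 (Ideal.Quotient.eq.1 (DFunLike.congr_fun hcomp F).symm)

theorem exists_eq_mul_add_aeval_update [IsDomain R] [DecidableEq σ] {s : σ} {g : MvPolynomial σ R}
    (hg : g.totalDegree ≤ 1) (hgs : coeff (Finsupp.single s 1) g = 0)
    (F : MvPolynomial σ R) :
    ∃ G, F = (X s - g) * G + aeval (Function.update X s g) F ∧
      (G = 0 ∨ G.totalDegree + 1 ≤ F.totalDegree) := by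
  obtain ⟨G, hG⟩ := X_sub_dvd_sub_aeval_update s g F
  refine ⟨G, sub_eq_iff_eq_add.1 hG, or_iff_not_imp_left.2 fun hG0 => ?_⟩
  have hsupp : Finsupp.single s 1 ∈ (X s - g).support := by
    simp [hgs, coeff_X]
  have hdeg : 1 ≤ (X s - g).totalDegree := by
    simpa using le_totalDegree hsupp
  have hX : X s - g ≠ 0 := fun h => by simp [h] at hsupp
  calc G.totalDegree + 1 ≤ (X s - g).totalDegree + G.totalDegree := by omega
    _ = (F - aeval (Function.update X s g) F).totalDegree := by
      rw [hG, totalDegree_mul_of_isDomain hX hG0]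
    _ ≤ F.totalDegree := (totalDegree_sub _ _).trans (max_le le_rfl
      (totalDegree_aeval_le (fun t => by
        rcases eq_or_ne t s with rfl | hts
        · rwa [Function.update_self]
        · rw [Function.update_of_ne hts, totalDegree_X]) F))

theorem eval_aeval_update [DecidableEq σ] (x : σ → R) (s : σ) (g F : MvPolynomial σ R) :
    eval x (aeval (Function.update X s g) F) = eval (Function.update x s (eval x g)) F := by
  rw [← aeval_eq_eval, ← AlgHom.comp_apply, ← aeval_eq_eval]
  refine DFunLike.congr_fun (algHom_ext fun t => ?_) F
  rw [AlgHom.comp_apply, aeval_X, aeval_X, aeval_eq_eval]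
  rcases eq_or_ne t s with rfl | hts
  · simp only [Function.update_self]
  · simp only [Function.update_of_ne hts, eval_X]

theorem totalDegree_C_sub_C_mul_X_le [Nontrivial R] (a b : R) (s : σ) :
    (C a - C b * X s : MvPolynomial σ R).totalDegree ≤ 1 := by
  refine (totalDegree_sub _ _).trans (max_le ?_ ((totalDegree_mul _ _).trans ?_))
  · rw [totalDegree_C]
    exact zero_le_one
  · rw [totalDegree_C, totalDegree_X]

theorem coeff_single_C_sub_C_mul_X {s t : σ} (h : t ≠ s) (a b : R) :
    coeff (Finsupp.single s 1) (C a - C b * X t) = 0 := by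
  classical
  simp [coeff_C_mul, coeff_X, coeff_C, Finsupp.single_left_inj, h, eq_comm (a := (0 : σ →₀ ℕ))]

end TotalDegree

section Vanishing

open MvPolynomial

variable {K : Type*} [CommRing K] [IsDomain K] [CharZero K]

theorem eval_ascPochhammer_neg_natCast_eq_zero_iff {d n : ℕ} :
    (ascPochhammer K d).eval (-n : K) = 0 ↔ n < d := by
  simp [ascPochhammer_eval_eq_zero_iff]

variable {r p d : ℕ} {Q : Set ℕ} {F : MvPolynomial (Fin 2) K}

theorem ascPochhammer_mul_eval_eq_zero {ψ : MvPolynomial (Fin 2) K}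
    (hF : ∀ i j : ℕ, j ∈ Q → i + r * j + d = p → eval ![(i : K), (j : K)] F = 0)
    (hψ : ∀ i j : ℕ, j ∈ Q → i + r * j ≤ p → eval ![(i : K), (j : K)] F =
      (ascPochhammer K d).eval (i + r * j - p : K) * eval ![(i : K), (j : K)] ψ)
    {i j : ℕ} (hj : j ∈ Q) (hp : i + r * j ≤ p) :
    (ascPochhammer K d).eval (i + r * j - p : K) * eval ![(p - d - r * j : K), (j : K)] ψ = 0 := by
  obtain ⟨n, rfl⟩ := Nat.exists_eq_add_of_le hp
  rw [mul_eq_zero, show (i + r * j - (i + r * j + n : ℕ) : K) = -n by push_cast; ring,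
    eval_ascPochhammer_neg_natCast_eq_zero_iff]
  refine or_iff_not_imp_left.2 fun hnd => ?_
  obtain ⟨m, rfl⟩ := Nat.exists_eq_add_of_le (not_lt.1 hnd)
  have hzero := hψ (i + m) j hj (by omega)
  rw [hF (i + m) j hj (by omega), eq_comm, mul_eq_zero,
    show ((i + m : ℕ) + r * j - (i + r * j + (d + m) : ℕ) : K) = -d by push_cast; ring,
    eval_ascPochhammer_neg_natCast_eq_zero_iff, or_iff_right (lt_irrefl d)] at hzero
  rw [← hzero]
  congr 3
  push_cast
  ring

/-- At the integer points with `i + r j ≤ p` where the first `d` factors of the rising factorial do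
not vanish, the next divisor `i + r j - p + d` vanishes at most on the diagonal `i + r j = p - d`;
the remainder depends on `j` alone, hence can be computed on that diagonal. -/
theorem exists_eval_eq_ascPochhammer_mul
    (hF : ∀ i j : ℕ, j ∈ Q → i + r * j ≤ p → p < i + r * j + d → eval ![(i : K), (j : K)] F = 0) :
    ∃ ψ : MvPolynomial (Fin 2) K, (ψ = 0 ∨ ψ.totalDegree + d ≤ F.totalDegree) ∧
      ∀ i j : ℕ, j ∈ Q → i + r * j ≤ p → eval ![(i : K), (j : K)] F =
        (ascPochhammer K d).eval (i + r * j - p : K) * eval ![(i : K), (j : K)] ψ := by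
  induction d with
  | zero => exact ⟨F, Or.inr le_rfl, by simp⟩
  | succ d ih =>
    obtain ⟨ψ, hψdeg, hψ⟩ := ih fun i j hj hp hpd => hF i j hj hp (by omega)
    let g : MvPolynomial (Fin 2) K := C (p - d : K) - C (r : K) * X 1
    have hg (x y : K) : eval ![x, y] g = p - d - r * y := by simp [g]
    obtain ⟨G, hG, hGdeg⟩ := exists_eq_mul_add_aeval_update
      (totalDegree_C_sub_C_mul_X_le (p - d : K) r 1)
      (coeff_single_C_sub_C_mul_X one_ne_zero _ _) ψ
    refine ⟨G, ?_, fun i j hj hp => ?_⟩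
    · rcases hGdeg with h | h
      · exact Or.inl h
      rcases hψdeg with rfl | h'
      · simp at h
      · right; omega
    have hψval : eval ![(i : K), (j : K)] ψ = (i - (p - d - r * j)) * eval ![(i : K), (j : K)] G +
        eval ![(p - d - r * j : K), (j : K)] ψ := by
      conv_lhs => rw [hG]
      rw [map_add, map_mul, map_sub, eval_X, eval_aeval_update, hg]
      congr 3
      ext t
      fin_cases t <;> rfl
    rw [hψ i j hj hp, hψval, mul_add, ascPochhammer_succ_eval,
      ascPochhammer_mul_eval_eq_zero (fun i j hj h => hF i j hj (by omega) (by omega)) hψ hj hp]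
    ring

end Vanishing

theorem exists_descFactorial_eq_mul_eval (R : Type*) [CommRing R] [Nontrivial R] {σ : Type*} (s : σ)
    {k₀ k : ℕ} (h : k₀ ≤ k) :
    ∃ Φ : MvPolynomial σ R, Φ.totalDegree ≤ k - k₀ ∧ ∀ x : σ → ℕ,
      ((x s).descFactorial k : R) =
        (x s).descFactorial k₀ * MvPolynomial.eval (fun t => (x t : R)) Φ := by
  induction k, h using Nat.le_induction with
  | base => exact ⟨1, by simp, by simp⟩
  | succ k hk ih =>
    obtain ⟨Φ, hΦ, hval⟩ := ih
    refine ⟨Φ * (MvPolynomial.X s - MvPolynomial.C (k : R)), ?_, fun x => ?_⟩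
    · have hX := MvPolynomial.totalDegree_sub_C_le (MvPolynomial.X s) (k : R)
      have hmul := MvPolynomial.totalDegree_mul Φ (MvPolynomial.X s - MvPolynomial.C (k : R))
      rw [MvPolynomial.totalDegree_X] at hX
      omega
    · have hcast : ((x s - k : ℕ) : R) * (x s).descFactorial k =
          ((x s : R) - k) * (x s).descFactorial k := by
        rcases le_or_gt k (x s) with hle | hlt
        · rw [Nat.cast_sub hle]
        · simp [Nat.descFactorial_of_lt hlt]
      rw [Nat.descFactorial_succ, Nat.cast_mul, hcast, hval]
      simp only [map_mul, map_sub, MvPolynomial.eval_X, MvPolynomial.eval_C]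
      ring

noncomputable section

namespace Staircase

variable {U : Opens (ℂ × ℂ)}

/-! ### Derivatives of smooth functions -/

theorem extZero_mul (f g : U → ℂ) : extZero U (f * g) = extZero U f * extZero U g := by
  funext z
  by_cases h : z ∈ U <;> simp [extZero, h]

theorem extZero_eventuallyEq {f : U → ℂ} {g : ℂ × ℂ → ℂ} (h : ∀ z : U, f z = g z) (z : U) :
    extZero U f =ᶠ[nhds (z : ℂ × ℂ)] g := by
  filter_upwards [U.isOpen.mem_nhds z.2] with w hw
  exact (extZero_apply U f hw).trans (h ⟨w, hw⟩)

theorem wirtinger_congr {g h : ℂ × ℂ → ℂ} {z : ℂ × ℂ} (v : ℂ × ℂ) (hgh : g =ᶠ[nhds z] h) :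
    wirtinger v g z = wirtinger v h z := by
  simp only [wirtinger, hgh.fderiv_eq]

theorem wirtinger_eq_fderiv {g : ℂ × ℂ → ℂ} {z : ℂ × ℂ} (hg : DifferentiableAt ℂ g z)
    (v : ℂ × ℂ) : wirtinger v g z = fderiv ℂ g z v := by
  simp only [wirtinger, hg.fderiv_restrictScalars ℝ, ContinuousLinearMap.coe_restrictScalars',
    map_smul, smul_eq_mul]
  linear_combination (-(fderiv ℂ g z v) / 2) * Complex.I_mul_I

theorem wirtinger_mul {f g : ℂ × ℂ → ℂ} {z : ℂ × ℂ} (v : ℂ × ℂ) (hf : DifferentiableAt ℝ f z)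
    (hg : DifferentiableAt ℝ g z) :
    wirtinger v (f * g) z = f z * wirtinger v g z + g z * wirtinger v f z := by
  simp only [wirtinger, fderiv_mul hf hg, add_apply, smul_apply, smul_eq_mul]
  ring

theorem fderiv_wirtinger {g : ℂ × ℂ → ℂ} {z : ℂ × ℂ} (w u : ℂ × ℂ)
    (hg : DifferentiableAt ℝ (fderiv ℝ g) z) :
    fderiv ℝ (wirtinger w g) z u = (fderiv ℝ (fderiv ℝ g) z u w
      - Complex.I * fderiv ℝ (fderiv ℝ g) z u (Complex.I • w)) / 2 := by
  have hasFDerivAt_apply (w : ℂ × ℂ) : HasFDerivAt (fun t => fderiv ℝ g t w)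
      ((fderiv ℝ (fderiv ℝ g) z).flip w) z := by
    simpa using hg.hasFDerivAt.clm_apply (hasFDerivAt_const w z)
  have h := ((hasFDerivAt_apply w).sub
    ((hasFDerivAt_apply (Complex.I • w)).const_mul Complex.I)).const_mul (2 : ℂ)⁻¹
  have hfun : wirtinger w g = fun t =>
      (2 : ℂ)⁻¹ * (fderiv ℝ g t w - Complex.I * fderiv ℝ g t (Complex.I • w)) :=
    funext fun t => div_eq_inv_mul _ _
  rw [hfun, div_eq_inv_mul]
  exact congrArg (fun L : ℂ × ℂ →L[ℝ] ℂ => L u) h.fderiv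

theorem wirtinger_wirtinger_comm {g : ℂ × ℂ → ℂ} {z : ℂ × ℂ} (v w : ℂ × ℂ)
    (hg : ContDiffAt ℝ 2 g z) :
    wirtinger v (wirtinger w g) z = wirtinger w (wirtinger v g) z := by
  have hd : DifferentiableAt ℝ (fderiv ℝ g) z :=
    (hg.fderiv_right (m := 1) (by norm_num)).differentiableAt (by simp)
  have hs : IsSymmSndFDerivAt ℝ g z :=
    hg.isSymmSndFDerivAt (minSmoothness_of_isRCLikeNormedField.le)
  rw [wirtinger, wirtinger]
  simp only [fderiv_wirtinger _ _ hd]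
  rw [hs.eq v w, hs.eq v (Complex.I • w), hs.eq (Complex.I • v) w,
    hs.eq (Complex.I • v) (Complex.I • w)]
  ring

theorem partialD_apply (v : ℂ × ℂ) (f : Smooth U) (z : U) :
    (partialD U v f : U → ℂ) z = wirtinger v (extZero U f) z := rfl

theorem partialD_apply_of_eq {f : Smooth U} {g : ℂ × ℂ → ℂ} (h : ∀ z : U, (f : U → ℂ) z = g z)
    (v : ℂ × ℂ) (z : U) : (partialD U v f : U → ℂ) z = wirtinger v g z :=
  wirtinger_congr v (extZero_eventuallyEq h z)

theorem partialD_X (v : ℂ × ℂ) : partialD U v (X U) = algebraMap ℂ (Smooth U) v.1 := by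
  ext z
  rw [partialD_apply_of_eq (g := ContinuousLinearMap.fst ℂ ℂ ℂ) fun _ => rfl,
    wirtinger_eq_fderiv (ContinuousLinearMap.differentiableAt _), ContinuousLinearMap.fderiv]
  rfl

theorem partialD_Y (v : ℂ × ℂ) : partialD U v (Y U) = algebraMap ℂ (Smooth U) v.2 := by
  ext z
  rw [partialD_apply_of_eq (g := ContinuousLinearMap.snd ℂ ℂ ℂ) fun _ => rfl,
    wirtinger_eq_fderiv (ContinuousLinearMap.differentiableAt _), ContinuousLinearMap.fderiv]
  rfl

theorem partialD_commute (v w : ℂ × ℂ) : Commute (partialD U v) (partialD U w) := by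
  ext f z
  rw [Module.End.mul_apply, Module.End.mul_apply, partialD_apply_of_eq (partialD_apply w f),
    partialD_apply_of_eq (partialD_apply v f)]
  exact wirtinger_wirtinger_comm v w
    (((f.2 : ContDiffOn ℝ ∞ (extZero U f) U).contDiffAt (U.isOpen.mem_nhds z.2)).of_le
      (WithTop.coe_le_coe.2 (le_top : (2 : ℕ∞) ≤ ⊤)))

/-- `partialD` as a derivation of the algebra of smooth functions. -/
def partialDer (U : Opens (ℂ × ℂ)) (v : ℂ × ℂ) : Derivation ℂ (Smooth U) (Smooth U) :=
  Derivation.mk' (partialD U v) fun f g => by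
    ext z
    simp only [partialD_apply, MulMemClass.coe_mul, extZero_mul, smul_eq_mul,
      wirtinger_mul v (differentiableAt_extZero f z.2) (differentiableAt_extZero g z.2),
      extZero_apply U _ z.2]
    rfl

/-- The monomial `x^i y^j` on `U`. -/
def mon (U : Opens (ℂ × ℂ)) (e : ℕ × ℕ) : Smooth U := X U ^ e.1 * Y U ^ e.2

theorem mon_mul_mon (e f : ℕ × ℕ) : mon U e * mon U f = mon U (e + f) := by
  simp only [mon, Prod.fst_add, Prod.snd_add, pow_add]
  ring

theorem partialD_mon (v : ℂ × ℂ) (i j : ℕ) :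
    partialD U v (mon U (i, j)) =
      (v.1 * i) • mon U (i - 1, j) + (v.2 * j) • mon U (i, j - 1) := by
  change partialDer U v (X U ^ i * Y U ^ j) = _
  have hX : partialDer U v (X U) = algebraMap ℂ (Smooth U) v.1 := partialD_X v
  have hY : partialDer U v (Y U) = algebraMap ℂ (Smooth U) v.2 := partialD_Y v
  rw [Derivation.leibniz, Derivation.leibniz_pow, Derivation.leibniz_pow, hX, hY]
  simp only [mon, smul_eq_mul, nsmul_eq_mul]
  simp only [Algebra.smul_def, map_mul, map_natCast]
  ring

theorem Dx_mon (i j : ℕ) : Dx U (mon U (i, j)) = (i : ℂ) • mon U (i - 1, j) := by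
  simp [Dx, partialD_mon]

theorem Dy_mon (i j : ℕ) : Dy U (mon U (i, j)) = (j : ℂ) • mon U (i, j - 1) := by
  simp [Dy, partialD_mon]

theorem Dx_pow_mon (k i j : ℕ) :
    (Dx U ^ k) (mon U (i, j)) = (i.descFactorial k : ℂ) • mon U (i - k, j) := by
  induction k with
  | zero => simp
  | succ k ih =>
    rw [pow_succ', Module.End.mul_apply, ih, map_smul, Dx_mon, smul_smul, Nat.descFactorial_succ,
      Nat.sub_sub, Nat.cast_mul, mul_comm]

theorem Dy_pow_mon (k i j : ℕ) :
    (Dy U ^ k) (mon U (i, j)) = (j.descFactorial k : ℂ) • mon U (i, j - k) := by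
  induction k with
  | zero => simp
  | succ k ih =>
    rw [pow_succ', Module.End.mul_apply, ih, map_smul, Dy_mon, smul_smul, Nat.descFactorial_succ,
      Nat.sub_sub, Nat.cast_mul, mul_comm]

/-- The operator `∂_x^{k₁} ∂_y^{k₂}`. -/
def diffMon (U : Opens (ℂ × ℂ)) (k : ℕ × ℕ) : Module.End ℂ (Smooth U) := Dx U ^ k.1 * Dy U ^ k.2

/-- The scalar `(i)_{k₁} (j)_{k₂}` (falling factorials) by which `∂_x^{k₁} ∂_y^{k₂}` multiplies the
monomial `x^i y^j` while lowering its exponents, where `e = (i, j)`. -/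
def fall (k e : ℕ × ℕ) : ℂ := (e.1.descFactorial k.1 : ℂ) * (e.2.descFactorial k.2 : ℂ)

theorem diffMon_mon (k e : ℕ × ℕ) : diffMon U k (mon U e) = fall k e • mon U (e - k) := by
  obtain ⟨i, j⟩ := e
  obtain ⟨k, l⟩ := k
  simp only [diffMon, Module.End.mul_apply, Dy_pow_mon, map_smul, Dx_pow_mon, smul_smul, fall,
    Prod.mk_sub_mk]
  rw [mul_comm]

theorem fall_eq_zero_iff {k e : ℕ × ℕ} : fall k e = 0 ↔ ¬ k ≤ e := by
  simp only [fall, mul_eq_zero, Nat.cast_eq_zero, Nat.descFactorial_eq_zero_iff_lt, Prod.le_def,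
    not_and_or, not_le]

theorem mon_linearIndependent (hU : (U : Set (ℂ × ℂ)).Nonempty) :
    LinearIndependent ℂ (mon U) := by
  obtain ⟨z, hz⟩ := hU
  rw [linearIndependent_iff]
  intro c hc
  by_contra hne
  obtain ⟨e, he, hmax⟩ := c.support.exists_maximal (Finsupp.support_nonempty_iff.2 hne)
  have hD : diffMon U e (Finsupp.linearCombination ℂ (mon U) c) = (c e * fall e e) • 1 := by
    rw [Finsupp.linearCombination_apply, Finsupp.sum, map_sum, Finset.sum_eq_single_of_mem e he]
    · rw [map_smul, diffMon_mon, smul_smul]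
      simp [mon]
    · intro f hf hfe
      rw [map_smul, diffMon_mon, fall_eq_zero_iff.2, zero_smul, smul_zero]
      exact fun hle => hfe (le_antisymm (hmax hf hle) hle)
  rw [hc, map_zero] at hD
  have hz0 : (0 : ℂ) = c e * fall e e := by
    simpa using congrFun (congrArg Subtype.val hD) ⟨z, hz⟩
  rcases mul_eq_zero.1 hz0.symm with h | h
  · exact Finsupp.mem_support_iff.1 he h
  · exact fall_eq_zero_iff.1 h le_rfl

theorem mem_adjoin_X_Y_iff (f : Smooth U) :
    f ∈ Algebra.adjoin ℂ {X U, Y U} ↔ f ∈ Submodule.span ℂ (Set.range (mon U)) := by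
  have hclosure : (Submonoid.closure {X U, Y U} : Set (Smooth U)) = Set.range (mon U) := by
    ext u
    simp only [SetLike.mem_coe, Submonoid.mem_closure_pair, Set.mem_range, Prod.exists, mon]
  rw [← Subalgebra.mem_toSubmodule, Algebra.adjoin_eq_span, hclosure]

/-! ### Operators and their coefficients -/

-- `Submodule.sub_mem` does not unify: the subtraction found on `Module.End ℂ (Smooth U)` is not
-- reducibly the one of its ring structure.
theorem end_sub_mem {N : Submodule ℂ (Module.End ℂ (Smooth U))} {S T : Module.End ℂ (Smooth U)}
    (hS : S ∈ N) (hT : T ∈ N) : S - T ∈ N := by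
  have h : S - T = S + (-1 : ℂ) • T := by
    ext u z
    rw [LinearMap.sub_apply]
    simp [sub_eq_add_neg]
  rw [h]
  exact N.add_mem hS (N.smul_mem _ hT)

theorem toOp_apply (f : ℕ × ℕ →₀ Smooth U) (u : Smooth U) :
    toOp U f u = f.sum fun k c => c * diffMon U k u := by
  rw [toOp, Finsupp.lsum_apply, Finsupp.sum, LinearMap.sum_apply]
  rfl

theorem toOp_single (k : ℕ × ℕ) (c : Smooth U) :
    toOp U (Finsupp.single k c) = mulOp c * diffMon U k := by
  rw [toOp, Finsupp.lsum_single]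
  rfl

theorem toOp_mon (f : ℕ × ℕ →₀ Smooth U) (e : ℕ × ℕ) :
    toOp U f (mon U e) = f.sum fun k c => fall k e • (c * mon U (e - k)) := by
  rw [toOp_apply]
  refine Finsupp.sum_congr fun k _ => ?_
  rw [diffMon_mon, mul_smul_comm]

theorem mem_opsOn {A : Set (ℕ × ℕ)} {T : Module.End ℂ (Smooth U)} :
    T ∈ opsOn U A ↔ ∃ f : ℕ × ℕ →₀ Smooth U, (∀ k ∉ A, f k = 0) ∧ toOp U f = T := by
  simp only [opsOn, Submodule.mem_map, Finsupp.mem_supported']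

theorem opsOn_mono {A B : Set (ℕ × ℕ)} (h : A ⊆ B) : opsOn U A ≤ opsOn U B :=
  Submodule.map_mono (Finsupp.supported_mono h)

theorem mulOp_mul_diffMon_mem_opsOn {A : Set (ℕ × ℕ)} {k : ℕ × ℕ} (hk : k ∈ A) (c : Smooth U) :
    mulOp c * diffMon U k ∈ opsOn U A :=
  ⟨Finsupp.single k c, Finsupp.single_mem_supported ℂ c hk, toOp_single k c⟩

theorem opsOn_le_iff {A : Set (ℕ × ℕ)} {N : Submodule ℂ (Module.End ℂ (Smooth U))} :
    opsOn U A ≤ N ↔ ∀ k ∈ A, ∀ c : Smooth U, mulOp c * diffMon U k ∈ N := by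
  refine ⟨fun h k hk c => h (mulOp_mul_diffMon_mem_opsOn hk c), fun h => ?_⟩
  rintro _ ⟨f, hf, rfl⟩
  rw [← Finsupp.sum_single f, Finsupp.sum, map_sum]
  refine sum_mem fun k hk => ?_
  rw [toOp_single]
  exact h k (hf hk) _

/-- Triangularity: `T (mon U e)` involves the coefficients at the exponents `k ≤ e` only, and the
coefficient at `e` itself up to the nonzero scalar `fall e e`. -/
theorem coeff_mem_of_toOp_mem {A : Set (ℕ × ℕ)} (hA : IsLowerSet A) {N : Submodule ℂ (Smooth U)}
    (hN : ∀ u ∈ N, ∀ e, u * mon U e ∈ N) {f : ℕ × ℕ →₀ Smooth U}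
    (h : ∀ e ∈ A, toOp U f (mon U e) ∈ N) : ∀ e ∈ A, f e ∈ N := by
  intro e
  induction e using WellFoundedLT.induction with
  | ind e ih =>
    intro he
    have hsum := h e he
    rw [toOp_mon, Finsupp.sum_of_support_subset f (Finset.subset_insert e _) _ (by simp),
      ← Finset.add_sum_erase _ _ (Finset.mem_insert_self e _)] at hsum
    have hlower : ∑ k ∈ (insert e f.support).erase e, fall k e • (f k * mon U (e - k)) ∈ N := by
      refine sum_mem fun k hk => ?_
      by_cases hke : k ≤ e
      · exact N.smul_mem _ (hN _ (ih k (lt_of_le_of_ne hke (Finset.ne_of_mem_erase hk))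
          (hA hke he)) _)
      · rw [fall_eq_zero_iff.2 hke, zero_smul]
        exact zero_mem _
    have hdiag : fall e e • (f e * mon U (e - e)) ∈ N := (add_mem_cancel_right hlower).1 hsum
    rw [N.smul_mem_iff fun h0 => fall_eq_zero_iff.1 h0 le_rfl] at hdiag
    simpa [mon] using hdiag

theorem toOp_filter_mon {A : Set (ℕ × ℕ)} [DecidablePred (· ∈ A)] (hA : IsLowerSet A)
    (f : ℕ × ℕ →₀ Smooth U) {e : ℕ × ℕ} (he : e ∈ A) :
    toOp U (f.filter (· ∈ A)) (mon U e) = toOp U f (mon U e) := by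
  rw [toOp_mon, toOp_mon, Finsupp.sum_filter_index, Finsupp.sum]
  refine Finset.sum_subset (Finset.filter_subset _ _) fun k hk hk' => ?_
  have hkA : k ∉ A := fun h => hk' (Finset.mem_filter.2 ⟨hk, h⟩)
  rw [fall_eq_zero_iff.2 fun hle => hkA (hA hle he), zero_smul]

theorem opsOn_ext {A : Set (ℕ × ℕ)} (hA : IsLowerSet A) {T T' : Module.End ℂ (Smooth U)}
    (hT : T ∈ opsOn U A) (hT' : T' ∈ opsOn U A) (h : ∀ e ∈ A, T (mon U e) = T' (mon U e)) :
    T = T' := by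
  refine sub_eq_zero.1 ?_
  obtain ⟨f, hf, hfT⟩ := mem_opsOn.1 (end_sub_mem hT hT')
  have hcoeff : ∀ e ∈ A, f e ∈ (⊥ : Submodule ℂ (Smooth U)) :=
    coeff_mem_of_toOp_mem hA (by simp) fun e he => by simp [hfT, h e he]
  have hf0 : f = 0 := Finsupp.ext fun e => by
    by_cases he : e ∈ A
    · exact hcoeff e he
    · exact hf e he
  rw [← hfT, hf0, map_zero]

theorem exists_truncation {A B : Set (ℕ × ℕ)} (hA : IsLowerSet A) {T : Module.End ℂ (Smooth U)}
    (hT : T ∈ opsOn U B) :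
    ∃ T' ∈ opsOn U (A ∩ B), ∀ e ∈ A, T' (mon U e) = T (mon U e) := by
  classical
  obtain ⟨f, hf, rfl⟩ := mem_opsOn.1 hT
  refine ⟨toOp U (f.filter (· ∈ A)), mem_opsOn.2 ⟨_, fun k hk => ?_, rfl⟩,
    fun e he => toOp_filter_mon hA f he⟩
  rw [Finsupp.filter_apply]
  split_ifs with h
  · exact hf k fun hB => hk ⟨h, hB⟩
  · rfl

theorem opsOn_inter {A : Set (ℕ × ℕ)} (hA : IsLowerSet A) (B : Set (ℕ × ℕ)) :
    opsOn U (A ∩ B) = opsOn U A ⊓ opsOn U B := by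
  refine le_antisymm
    (le_inf (opsOn_mono Set.inter_subset_left) (opsOn_mono Set.inter_subset_right)) ?_
  rintro T ⟨hTA, hTB⟩
  obtain ⟨T', hT', h⟩ := exists_truncation hA hTB
  rwa [opsOn_ext hA hTA (opsOn_mono Set.inter_subset_left hT') fun e he => (h e he).symm]

section Stairs

variable {r p q : ℕ}

theorem stairs_isLowerSet (r p q : ℕ) : IsLowerSet (stairs r p q) := by
  rintro ⟨i, j⟩ ⟨i', j'⟩ h ⟨hp, hq⟩
  obtain ⟨hi, hj⟩ := Prod.mk_le_mk.1 h
  exact ⟨(add_le_add hi (Nat.mul_le_mul_left r hj)).trans hp, hj.trans hq⟩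

theorem mon_mem_stairModule {e : ℕ × ℕ} (he : e ∈ stairs r p q) :
    mon U e ∈ stairModule U r p q :=
  Submodule.subset_span ⟨e, he, rfl⟩

theorem forall_stairModule_mem {T : Module.End ℂ (Smooth U)} {N : Submodule ℂ (Smooth U)} :
    (∀ u ∈ stairModule U r p q, T u ∈ N) ↔ ∀ e ∈ stairs r p q, T (mon U e) ∈ N := by
  refine ⟨fun h e he => h _ (mon_mem_stairModule he), fun h u hu => ?_⟩
  have hle : stairModule U r p q ≤ N.comap T := Submodule.span_le.2 (by
    rintro _ ⟨e, he, rfl⟩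
    exact h e he)
  exact hle hu

theorem mem_preserving_iff {T : Module.End ℂ (Smooth U)} :
    T ∈ preserving U r p q ↔
      T ∈ diffOps U ∧ ∀ e ∈ stairs r p q, T (mon U e) ∈ stairModule U r p q :=
  and_congr_right fun _ => forall_stairModule_mem

theorem mem_kerRestrict_iff {T : Module.End ℂ (Smooth U)} :
    T ∈ kerRestrict U r p q ↔ T ∈ diffOps U ∧ ∀ e ∈ stairs r p q, T (mon U e) = 0 := by
  constructor
  · exact fun h => ⟨h.1.1, fun e he => h.2 _ (mon_mem_stairModule he)⟩
  · rintro ⟨hT, h⟩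
    refine ⟨mem_preserving_iff.2 ⟨hT, fun e he => ?_⟩, forall_stairModule_mem (N := ⊥).2 h⟩
    rw [h e he]
    exact zero_mem _

theorem disjoint_complement_kerRestrict (U : Opens (ℂ × ℂ)) (r p q : ℕ) :
    Disjoint (complement U r p q) (kerRestrict U r p q) := by
  rw [Submodule.disjoint_def]
  intro T hT hT'
  exact opsOn_ext (stairs_isLowerSet r p q) hT.2 (zero_mem _) (mem_kerRestrict_iff.1 hT').2

theorem complement_sup_kerRestrict (U : Opens (ℂ × ℂ)) (r p q : ℕ) :
    complement U r p q ⊔ kerRestrict U r p q = preserving U r p q := by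
  refine le_antisymm (sup_le inf_le_left fun T hT => hT.1) fun T hT => ?_
  obtain ⟨T', hT', h⟩ := exists_truncation (stairs_isLowerSet r p q) hT.1
  rw [Set.inter_univ] at hT'
  have hT'diff : T' ∈ diffOps U := opsOn_mono (Set.subset_univ _) hT'
  have hT'pres : T' ∈ preserving U r p q := mem_preserving_iff.2 ⟨hT'diff, fun e he => by
    rw [h e he]
    exact hT.2 _ (mon_mem_stairModule he)⟩
  have hker : T - T' ∈ kerRestrict U r p q :=
    mem_kerRestrict_iff.2 ⟨end_sub_mem hT.1 hT'diff, fun e he => by simp [h e he]⟩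
  rw [← add_sub_cancel T' T]
  exact Submodule.add_mem_sup ⟨hT'pres, hT'⟩ hker

theorem isProjection_of_eq_on_stairs {P T : Module.End ℂ (Smooth U)} (hP : P ∈ diffOps U)
    (hT : T ∈ complement U r p q) (h : ∀ e ∈ stairs r p q, P (mon U e) = T (mon U e)) :
    IsProjection U r p q P T := by
  refine ⟨mem_preserving_iff.2 ⟨hP, fun e he => ?_⟩, hT,
    mem_kerRestrict_iff.2 ⟨end_sub_mem hP hT.1.1, fun e he => by simp [h e he]⟩⟩
  rw [h e he]
  exact hT.1.2 _ (mon_mem_stairModule he)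

theorem IsProjection.eq {P T : Module.End ℂ (Smooth U)} (h : IsProjection U r p q P T)
    (hP : P ∈ opsOn U (stairs r p q)) : P = T := by
  refine opsOn_ext (stairs_isLowerSet r p q) hP h.2.1.2 fun e he => ?_
  simpa [sub_eq_zero] using (mem_kerRestrict_iff.1 h.2.2).2 e he

end Stairs

theorem opsOfOrderLE_mono {k l : ℕ} (h : k ≤ l) : opsOfOrderLE U k ≤ opsOfOrderLE U l :=
  opsOn_mono fun _ hk => le_trans hk h

theorem partialD_mul_mulOp (v : ℂ × ℂ) (f : Smooth U) :
    partialD U v * mulOp f = mulOp f * partialD U v + mulOp (partialD U v f) := by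
  refine LinearMap.ext fun g => ((partialDer U v).leibniz f g).trans ?_
  rw [smul_eq_mul, smul_eq_mul, mul_comm g]
  rfl

theorem Dx_mul_diffMon (e : ℕ × ℕ) : Dx U * diffMon U e = diffMon U (e + (1, 0)) := by
  rw [diffMon, ← mul_assoc, ← pow_succ']
  rfl

theorem Dy_mul_diffMon (e : ℕ × ℕ) : Dy U * diffMon U e = diffMon U (e + (0, 1)) := by
  have hcomm : Commute (Dy U) (Dx U ^ e.1) := (partialD_commute _ _).pow_right _
  rw [diffMon, ← mul_assoc, hcomm.eq, mul_assoc, ← pow_succ']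
  rfl

theorem mulOp_mul_mem_opsOfOrderLE {k : ℕ} {T : Module.End ℂ (Smooth U)}
    (hT : T ∈ opsOfOrderLE U k) (c : Smooth U) : mulOp c * T ∈ opsOfOrderLE U k := by
  have hle : opsOfOrderLE U k ≤ (opsOfOrderLE U k).comap (LinearMap.mulLeft ℂ (mulOp c)) := by
    refine opsOn_le_iff.2 fun e he f => ?_
    have hmul : mulOp c * (mulOp f * diffMon U e) = mulOp (c * f) * diffMon U e := by
      ext1 u
      simp
    rw [Submodule.mem_comap, LinearMap.mulLeft_apply, hmul]
    exact mulOp_mul_diffMon_mem_opsOn he _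
  exact hle hT

theorem partialD_mul_mem_opsOfOrderLE {v : ℂ × ℂ} {d : ℕ × ℕ} (hd : d.1 + d.2 = 1)
    (hv : ∀ e, partialD U v * diffMon U e = diffMon U (e + d)) {k : ℕ}
    {T : Module.End ℂ (Smooth U)} (hT : T ∈ opsOfOrderLE U k) :
    partialD U v * T ∈ opsOfOrderLE U (k + 1) := by
  have hle : opsOfOrderLE U k ≤
      (opsOfOrderLE U (k + 1)).comap (LinearMap.mulLeft ℂ (partialD U v)) := by
    refine opsOn_le_iff.2 fun e he f => ?_
    have hek : e.1 + e.2 ≤ k := he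
    rw [Submodule.mem_comap, LinearMap.mulLeft_apply, ← mul_assoc, partialD_mul_mulOp, add_mul,
      mul_assoc, hv]
    refine add_mem (mulOp_mul_diffMon_mem_opsOn ?_ _) (mulOp_mul_diffMon_mem_opsOn ?_ _)
    · change e.1 + d.1 + (e.2 + d.2) ≤ k + 1
      omega
    · exact hek.trans k.le_succ
  exact hle hT

theorem pow_mul_mem_opsOfOrderLE {D : Module.End ℂ (Smooth U)}
    (hD : ∀ {k T}, T ∈ opsOfOrderLE U k → D * T ∈ opsOfOrderLE U (k + 1)) {k : ℕ}
    {T : Module.End ℂ (Smooth U)} (hT : T ∈ opsOfOrderLE U k) (n : ℕ) :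
    D ^ n * T ∈ opsOfOrderLE U (k + n) := by
  induction n with
  | zero => rwa [pow_zero, one_mul]
  | succ n ih =>
    rw [pow_succ', mul_assoc]
    exact hD ih

theorem diffMon_mul_mem_opsOfOrderLE {k : ℕ} {T : Module.End ℂ (Smooth U)}
    (hT : T ∈ opsOfOrderLE U k) (e : ℕ × ℕ) :
    diffMon U e * T ∈ opsOfOrderLE U (k + e.2 + e.1) := by
  rw [diffMon, mul_assoc]
  exact pow_mul_mem_opsOfOrderLE (partialD_mul_mem_opsOfOrderLE rfl Dx_mul_diffMon)
    (pow_mul_mem_opsOfOrderLE (partialD_mul_mem_opsOfOrderLE rfl Dy_mul_diffMon) hT _) _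

theorem mulOp_mem_opsOfOrderLE_zero (c : Smooth U) : mulOp c ∈ opsOfOrderLE U 0 := by
  have h : mulOp c * diffMon U 0 ∈ opsOfOrderLE U 0 :=
    mulOp_mul_diffMon_mem_opsOn (k := 0) (Nat.le_refl 0) c
  rwa [show diffMon U 0 = 1 from mul_one 1, mul_one] at h

instance opsOfOrderLE_gradedMonoid : SetLike.GradedMonoid (opsOfOrderLE U) where
  one_mem := by
    have h1 : (1 : Module.End ℂ (Smooth U)) = mulOp 1 := LinearMap.ext fun u => (one_mul u).symm
    rw [h1]
    exact mulOp_mem_opsOfOrderLE_zero 1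
  mul_mem := by
    intro k l S T hS hT
    have hle : opsOfOrderLE U k ≤ (opsOfOrderLE U (k + l)).comap (LinearMap.mulRight ℂ T) := by
      refine opsOn_le_iff.2 fun e he f => ?_
      have hek : e.1 + e.2 ≤ k := he
      rw [Submodule.mem_comap, LinearMap.mulRight_apply, mul_assoc]
      exact mulOp_mul_mem_opsOfOrderLE
        (opsOfOrderLE_mono (by omega) (diffMon_mul_mem_opsOfOrderLE hT e)) f
    exact hle hS

theorem Dx_mem_opsOfOrderLE_one : Dx U ∈ opsOfOrderLE U 1 := by
  rw [← mul_one (Dx U)]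
  exact partialD_mul_mem_opsOfOrderLE rfl Dx_mul_diffMon SetLike.GradedOne.one_mem

theorem Dy_mem_opsOfOrderLE_one : Dy U ∈ opsOfOrderLE U 1 := by
  rw [← mul_one (Dy U)]
  exact partialD_mul_mem_opsOfOrderLE rfl Dy_mul_diffMon SetLike.GradedOne.one_mem

theorem gen_mem_opsOfOrderLE_one (r p : ℕ) (s : Fin (r + 5)) :
    gen U r p s ∈ opsOfOrderLE U 1 := by
  have hx (c : Smooth U) := mulOp_mul_mem_opsOfOrderLE Dx_mem_opsOfOrderLE_one c
  have hy (c : Smooth U) := mulOp_mul_mem_opsOfOrderLE Dy_mem_opsOfOrderLE_one c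
  have hmul (c : Smooth U) := opsOfOrderLE_mono zero_le_one (mulOp_mem_opsOfOrderLE_zero c)
  have hone : (1 : Module.End ℂ (Smooth U)) ∈ opsOfOrderLE U 1 :=
    opsOfOrderLE_mono zero_le_one SetLike.GradedOne.one_mem
  change genAux U r p s ∈ _
  match (s : ℕ) with
  | 0 => exact Dx_mem_opsOfOrderLE_one
  | 1 =>
    exact end_sub_mem (add_mem (hx _) (Submodule.smul_mem _ _ (hy _)))
      (Submodule.smul_mem _ _ (hmul _))
  | 2 => exact end_sub_mem (hx _) (Submodule.smul_mem _ _ hone)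
  | 3 => exact hy _
  | _ + 4 => exact hy _

theorem evalGen_mem_opsOfOrderLE (r p : ℕ) (P : MvPolynomial (Fin (r + 5)) ℂ) :
    evalGen U r p P ∈ opsOfOrderLE U P.totalDegree := by
  refine sum_mem fun K hK => Submodule.smul_mem _ _ ?_
  have hprod := SetLike.list_prod_ofFn_mem_graded (A := opsOfOrderLE U) (fun s => K s • 1)
    (fun s => gen U r p s ^ K s)
    fun s => SetLike.pow_mem_graded (K s) (gen_mem_opsOfOrderLE_one r p s)
  refine opsOfOrderLE_mono ?_ hprod
  rw [List.sum_ofFn]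
  simpa [Finsupp.sum_fintype] using MvPolynomial.le_totalDegree hK

/-! ### Polynomial operators and bidegrees -/

/-- The operator `∑ G(k, m) x^{m₁} y^{m₂} ∂_x^{k₁} ∂_y^{k₂}`: the polynomial differential operator
with normally ordered coefficients `G`, indexed by pairs (derivative exponent, monomial exponent).
-/
def polyOp (U : Opens (ℂ × ℂ)) : ((ℕ × ℕ) × (ℕ × ℕ) →₀ ℂ) →ₗ[ℂ] Module.End ℂ (Smooth U) :=
  Finsupp.linearCombination ℂ fun t => mulOp (mon U t.2) * diffMon U t.1

/-- The bidegree `m - k` of the operator `x^{m₁} y^{m₂} ∂_x^{k₁} ∂_y^{k₂}`, where `t = (k, m)`. -/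
def bidegree (t : (ℕ × ℕ) × (ℕ × ℕ)) : ℤ × ℤ :=
  ((t.2.1 : ℤ) - t.1.1, (t.2.2 : ℤ) - t.1.2)

/-- The exponents `e + d`, as a set with at most one element that is empty if `e + d` has a negative
entry. -/
def translate (e : ℕ × ℕ) (d : ℤ × ℤ) : Set (ℕ × ℕ) :=
  {m | (m.1 : ℤ) = e.1 + d.1 ∧ (m.2 : ℤ) = e.2 + d.2}

/-- The symbol of the operator with coefficients `G`, as a function of the exponent `e`: if all the
terms have bidegree `d`, then `mon U e` is mapped to `symb G e` times the monomial of
exponent `e + d`. -/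
def symb (G : (ℕ × ℕ) × (ℕ × ℕ) →₀ ℂ) (e : ℕ × ℕ) : ℂ := G.sum fun t c => c * fall t.1 e

theorem pairwise_disjoint_translate (e : ℕ × ℕ) :
    Pairwise (Function.onFun Disjoint (translate e)) := by
  intro d d' hne
  refine Set.disjoint_left.2 fun m hm hm' => hne ?_
  exact Prod.ext (add_left_cancel (hm.1.symm.trans hm'.1))
    (add_left_cancel (hm.2.symm.trans hm'.2))

theorem mon_mem_adjoin (e : ℕ × ℕ) : mon U e ∈ Algebra.adjoin ℂ {X U, Y U} :=
  (mem_adjoin_X_Y_iff _).2 (Submodule.subset_span (Set.mem_range_self e))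

theorem polyOp_mem_opsOn {B : Set (ℕ × ℕ)} {G : (ℕ × ℕ) × (ℕ × ℕ) →₀ ℂ}
    (hG : ∀ t ∈ G.support, t.1 ∈ B) : polyOp U G ∈ opsOn U B :=
  Submodule.sum_mem _ fun t ht =>
    Submodule.smul_mem _ _ (mulOp_mul_diffMon_mem_opsOn (hG t ht) _)

theorem mulOp_mul_diffMon_mem_span {B : Set (ℕ × ℕ)} {k : ℕ × ℕ} (hk : k ∈ B) {c : Smooth U}
    (hc : c ∈ Submodule.span ℂ (Set.range (mon U))) :
    mulOp c * diffMon U k ∈ Submodule.span ℂ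
      ((fun t : (ℕ × ℕ) × (ℕ × ℕ) => mulOp (mon U t.2) * diffMon U t.1) '' {t | t.1 ∈ B}) := by
  have hle : Submodule.span ℂ (Set.range (mon U)) ≤ (Submodule.span ℂ
      ((fun t : (ℕ × ℕ) × (ℕ × ℕ) => mulOp (mon U t.2) * diffMon U t.1) '' {t | t.1 ∈ B})).comap
      ((toOp U).comp (Finsupp.lsingle k)) := by
    refine Submodule.span_le.2 ?_
    rintro _ ⟨m, rfl⟩
    exact Submodule.subset_span ⟨(k, m), hk, (toOp_single k _).symm⟩
  have h := hle hc
  rwa [Submodule.mem_comap, LinearMap.comp_apply, Finsupp.lsingle_apply, toOp_single] at h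

theorem exists_polyOp_eq {A : Set (ℕ × ℕ)} (hA : IsLowerSet A) {T : Module.End ℂ (Smooth U)}
    {B : Set (ℕ × ℕ)} (hTA : T ∈ opsOn U A) (hTB : T ∈ opsOn U B)
    (h : ∀ e ∈ A, T (mon U e) ∈ Submodule.span ℂ (Set.range (mon U))) :
    ∃ G : (ℕ × ℕ) × (ℕ × ℕ) →₀ ℂ, (∀ t ∈ G.support, t.1 ∈ A ∩ B) ∧ polyOp U G = T := by
  have hT : T ∈ opsOn U (A ∩ B) := by
    rw [opsOn_inter hA]
    exact ⟨hTA, hTB⟩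
  obtain ⟨f, hf, rfl⟩ := mem_opsOn.1 hT
  have hpoly := coeff_mem_of_toOp_mem hA (fun u hu e => by
    rw [← mem_adjoin_X_Y_iff] at hu ⊢
    exact Subalgebra.mul_mem _ hu (mon_mem_adjoin e)) h
  have hmem : toOp U f ∈ Submodule.span ℂ
      ((fun t : (ℕ × ℕ) × (ℕ × ℕ) => mulOp (mon U t.2) * diffMon U t.1) ''
        {t | t.1 ∈ A ∩ B}) := by
    rw [← Finsupp.sum_single f, Finsupp.sum, map_sum]
    refine Submodule.sum_mem _ fun k hk => ?_
    have hkAB : k ∈ A ∩ B := by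
      by_contra hkAB
      exact Finsupp.mem_support_iff.1 hk (hf k hkAB)
    rw [toOp_single]
    exact mulOp_mul_diffMon_mem_span hkAB (hpoly k hkAB.1)
  obtain ⟨G, hG, hGT⟩ := (Finsupp.mem_span_image_iff_linearCombination ℂ).1 hmem
  exact ⟨G, fun t ht => hG ht, hGT⟩

theorem polyOp_eq_sum_filter (G : (ℕ × ℕ) × (ℕ × ℕ) →₀ ℂ) :
    polyOp U G = ∑ d ∈ G.support.image bidegree, polyOp U (G.filter (bidegree · = d)) := by
  classical
  simp only [polyOp, Finsupp.linearCombination_apply, Finsupp.sum_filter_index,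
    Finsupp.support_filter]
  exact (Finset.sum_fiberwise_of_maps_to (fun t ht => Finset.mem_image_of_mem bidegree ht) _).symm

theorem bidegree_eq_of_mem_support_filter {G : (ℕ × ℕ) × (ℕ × ℕ) →₀ ℂ} {d : ℤ × ℤ} :
    ∀ t ∈ (G.filter (bidegree · = d)).support, bidegree t = d := by
  intro t ht
  rw [Finsupp.support_filter, Finset.mem_filter] at ht
  exact ht.2

theorem polyOp_mon (G : (ℕ × ℕ) × (ℕ × ℕ) →₀ ℂ) (e : ℕ × ℕ) :
    polyOp U G (mon U e) = G.sum fun t c => (c * fall t.1 e) • mon U (t.2 + (e - t.1)) := by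
  rw [polyOp, Finsupp.linearCombination_apply, Finsupp.sum, LinearMap.sum_apply]
  refine Finset.sum_congr rfl fun t _ => ?_
  rw [LinearMap.smul_apply, Module.End.mul_apply, diffMon_mon, map_smul, LinearMap.mulLeft_apply,
    mon_mul_mon, smul_smul]

theorem add_sub_mem_translate {t : (ℕ × ℕ) × (ℕ × ℕ)} {e : ℕ × ℕ} (h : t.1 ≤ e) :
    t.2 + (e - t.1) ∈ translate e (bidegree t) := by
  rw [Prod.le_def] at h
  simp only [translate, bidegree, Set.mem_ofPred_eq, Prod.fst_add, Prod.snd_add, Prod.fst_sub,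
    Prod.snd_sub]
  omega

theorem eq_of_mem_translate {e m m' : ℕ × ℕ} {d : ℤ × ℤ} (hm : m ∈ translate e d)
    (hm' : m' ∈ translate e d) : m = m' :=
  Prod.ext (Nat.cast_injective (hm.1.trans hm'.1.symm))
    (Nat.cast_injective (hm.2.trans hm'.2.symm))

section Homogeneous

variable {G : (ℕ × ℕ) × (ℕ × ℕ) →₀ ℂ} {d : ℤ × ℤ}

theorem polyOp_mon_mem_span_translate (hG : ∀ t ∈ G.support, bidegree t = d) (e : ℕ × ℕ) :
    polyOp U G (mon U e) ∈ Submodule.span ℂ (mon U '' translate e d) := by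
  rw [polyOp_mon]
  refine Submodule.sum_mem _ fun t ht => ?_
  by_cases hle : t.1 ≤ e
  · exact Submodule.smul_mem _ _
      (Submodule.subset_span ⟨_, hG t ht ▸ add_sub_mem_translate hle, rfl⟩)
  · simp only [fall_eq_zero_iff.2 hle, mul_zero, zero_smul]
    exact Submodule.zero_mem _

theorem polyOp_mon_of_mem_translate (hG : ∀ t ∈ G.support, bidegree t = d) {e m : ℕ × ℕ}
    (hm : m ∈ translate e d) : polyOp U G (mon U e) = symb G e • mon U m := by
  rw [polyOp_mon, symb, Finsupp.sum, Finsupp.sum, Finset.sum_smul]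
  refine Finset.sum_congr rfl fun t ht => ?_
  by_cases hle : t.1 ≤ e
  · have hmem := add_sub_mem_translate hle
    rw [hG t ht] at hmem
    rw [eq_of_mem_translate hmem hm]
  · simp only [fall_eq_zero_iff.2 hle, mul_zero, zero_smul]

theorem polyOp_filter_mon_mem_span (hU : (U : Set (ℂ × ℂ)).Nonempty)
    (hd : d ∈ G.support.image bidegree) {e : ℕ × ℕ} {S : Set (ℕ × ℕ)}
    (h : polyOp U G (mon U e) ∈ Submodule.span ℂ (mon U '' S)) :
    polyOp U (G.filter (bidegree · = d)) (mon U e) ∈ Submodule.span ℂ (mon U '' S) := by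
  rw [polyOp_eq_sum_filter, LinearMap.sum_apply] at h
  exact mem_span_image_of_sum_mem (mon_linearIndependent hU) (pairwise_disjoint_translate e)
    (fun d => polyOp_mon_mem_span_translate bidegree_eq_of_mem_support_filter e) h hd

theorem symb_eq_zero_of_notMem (hU : (U : Set (ℂ × ℂ)).Nonempty)
    (hG : ∀ t ∈ G.support, bidegree t = d) {e m : ℕ × ℕ} (hm : m ∈ translate e d)
    {S : Set (ℕ × ℕ)} (hmS : m ∉ S)
    (h : polyOp U G (mon U e) ∈ Submodule.span ℂ (mon U '' S)) : symb G e = 0 := by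
  rw [polyOp_mon_of_mem_translate hG hm] at h
  by_contra h0
  exact (mon_linearIndependent hU).notMem_span_image hmS
    ((Submodule.smul_mem_iff _ h0).1 h)

end Homogeneous

theorem isPolyOp_mulOp_mul_diffMon {c : Smooth U} (hc : c ∈ Algebra.adjoin ℂ {X U, Y U})
    (k : ℕ × ℕ) : IsPolyOp (mulOp c * diffMon U k) := by
  classical
  refine ⟨Finsupp.single k c, fun l => ?_, toOp_single k c⟩
  rw [Finsupp.single_apply]
  split_ifs
  · exact hc
  · exact Subalgebra.zero_mem _

theorem IsPolyOp.add {S T : Module.End ℂ (Smooth U)} (hS : IsPolyOp S) (hT : IsPolyOp T) :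
    IsPolyOp (S + T) := by
  obtain ⟨f, hf, rfl⟩ := hS
  obtain ⟨g, hg, rfl⟩ := hT
  exact ⟨f + g, fun k => Subalgebra.add_mem _ (hf k) (hg k), map_add _ _ _⟩

theorem IsPolyOp.smul {T : Module.End ℂ (Smooth U)} (hT : IsPolyOp T) (c : ℂ) :
    IsPolyOp (c • T) := by
  obtain ⟨f, hf, rfl⟩ := hT
  exact ⟨c • f, fun k => Subalgebra.smul_mem _ (hf k) c, map_smul _ _ _⟩

theorem isPolyOp_polyOp (G : (ℕ × ℕ) × (ℕ × ℕ) →₀ ℂ) : IsPolyOp (polyOp U G) := by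
  rw [polyOp, Finsupp.linearCombination_apply]
  refine Finset.sum_induction _ IsPolyOp (fun _ _ => IsPolyOp.add)
    ⟨0, fun _ => Subalgebra.zero_mem _, map_zero _⟩ fun t _ => ?_
  exact (isPolyOp_mulOp_mul_diffMon (mon_mem_adjoin t.2) t.1).smul _

theorem hasBidegree_iff {T : Module.End ℂ (Smooth U)} {a b : ℤ} :
    HasBidegree T a b ↔
      IsPolyOp T ∧ ∀ e, T (mon U e) ∈ Submodule.span ℂ (mon U '' translate e (a, b)) := by
  have hset (i j : ℕ) : {u : Smooth U | ∃ m n : ℕ, (m : ℤ) = i + a ∧ (n : ℤ) = j + b ∧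
      u = X U ^ m * Y U ^ n} = mon U '' translate (i, j) (a, b) := by
    ext u
    constructor
    · rintro ⟨m, n, hm, hn, rfl⟩
      exact ⟨(m, n), ⟨hm, hn⟩, rfl⟩
    · rintro ⟨⟨m, n⟩, ⟨hm, hn⟩, rfl⟩
      exact ⟨m, n, hm, hn, rfl⟩
  simp only [HasBidegree, hset, Prod.forall]
  rfl

theorem hasBidegree_polyOp {G : (ℕ × ℕ) × (ℕ × ℕ) →₀ ℂ} {d : ℤ × ℤ}
    (hG : ∀ t ∈ G.support, bidegree t = d) : HasBidegree (polyOp U G) d.1 d.2 :=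
  hasBidegree_iff.2 ⟨isPolyOp_polyOp G, polyOp_mon_mem_span_translate hG⟩

theorem eq_zero_of_mem_span_disjoint (hU : (U : Set (ℂ × ℂ)).Nonempty) {S S' : Set (ℕ × ℕ)}
    (hS : Disjoint S S') {u : Smooth U} (hu : u ∈ Submodule.span ℂ (mon U '' S))
    (hu' : u ∈ Submodule.span ℂ (mon U '' S')) : u = 0 :=
  Submodule.disjoint_def.1 ((mon_linearIndependent hU).disjoint_span_image hS) u hu hu'

/-- The polynomials of degree at most `n` in `y`. -/
def yDegreeLE (U : Opens (ℂ × ℂ)) (n : ℕ) : Submodule ℂ (Smooth U) :=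
  Submodule.span ℂ (mon U '' {m | m.2 ≤ n})

theorem mon_mem_yDegreeLE {m : ℕ × ℕ} {n : ℕ} (h : m.2 ≤ n) : mon U m ∈ yDegreeLE U n :=
  Submodule.subset_span ⟨m, h, rfl⟩

theorem yDegreeLE_mono {m n : ℕ} (h : m ≤ n) : yDegreeLE U m ≤ yDegreeLE U n :=
  Submodule.span_mono (Set.image_mono fun _ hk => le_trans hk h)

theorem disjoint_translate_of_pos {d : ℤ × ℤ} (hd : 0 < d.2) (e : ℕ × ℕ) :
    Disjoint (translate e d) {m | m.2 ≤ e.2} := by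
  refine Set.disjoint_left.2 fun m hm (hm' : m.2 ≤ e.2) => ?_
  have := hm.2
  omega

theorem span_translate_le_yDegreeLE {d : ℤ × ℤ} (hd : d.2 ≤ 0) (e : ℕ × ℕ) :
    Submodule.span ℂ (mon U '' translate e d) ≤ yDegreeLE U e.2 := by
  refine Submodule.span_mono (Set.image_mono fun m hm => ?_)
  have := hm.2
  change m.2 ≤ e.2
  omega

section ComplementDown

variable {r p q : ℕ} {T : Module.End ℂ (Smooth U)}

theorem exists_polyOp_eq_of_mem_complement (hT : T ∈ complement U r p q) {B : Set (ℕ × ℕ)}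
    (hTB : T ∈ opsOn U B) :
    ∃ G : (ℕ × ℕ) × (ℕ × ℕ) →₀ ℂ, (∀ t ∈ G.support, t.1 ∈ stairs r p q ∩ B) ∧ polyOp U G = T :=
  exists_polyOp_eq (stairs_isLowerSet r p q) hT.2 hTB fun _ he =>
    Submodule.span_mono (Set.image_subset_range _ _) (hT.1.2 _ (mon_mem_stairModule he))

theorem polyOp_filter_mon_eq_zero (hU : (U : Set (ℂ × ℂ)).Nonempty)
    {G : (ℕ × ℕ) × (ℕ × ℕ) →₀ ℂ} {d : ℤ × ℤ} (hd : d ∈ G.support.image bidegree)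
    (hd0 : 0 < d.2) {e : ℕ × ℕ} (h : polyOp U G (mon U e) ∈ yDegreeLE U e.2) :
    polyOp U (G.filter (bidegree · = d)) (mon U e) = 0 :=
  eq_zero_of_mem_span_disjoint hU (disjoint_translate_of_pos hd0 e)
    (polyOp_mon_mem_span_translate bidegree_eq_of_mem_support_filter e)
    (polyOp_filter_mon_mem_span hU hd h)

theorem apply_mon_mem_yDegreeLE (hT : T ∈ complementDown U r p q) (e : ℕ × ℕ) :
    T (mon U e) ∈ yDegreeLE U e.2 := by
  have hle : Submodule.span ℂ {T : Module.End ℂ (Smooth U) | ∃ a b : ℤ, b ≤ 0 ∧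
      HasBidegree T a b} ≤ (yDegreeLE U e.2).comap (LinearMap.applyₗ (mon U e)) := by
    refine Submodule.span_le.2 ?_
    rintro S ⟨a, b, hb, hS⟩
    exact span_translate_le_yDegreeLE (d := (a, b)) hb e ((hasBidegree_iff.1 hS).2 e)
  exact hle hT.2

theorem mem_complementDown_iff (hU : (U : Set (ℂ × ℂ)).Nonempty) :
    T ∈ complementDown U r p q ↔
      T ∈ complement U r p q ∧ ∀ e ∈ stairs r p q, T (mon U e) ∈ yDegreeLE U e.2 := by
  refine ⟨fun hT => ⟨hT.1, fun e _ => apply_mon_mem_yDegreeLE hT e⟩, fun ⟨hT, hy⟩ => ⟨hT, ?_⟩⟩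
  obtain ⟨G, hG, rfl⟩ := exists_polyOp_eq_of_mem_complement hT hT.2
  rw [polyOp_eq_sum_filter]
  refine Submodule.sum_mem _ fun d hd => ?_
  by_cases hd0 : d.2 ≤ 0
  · exact Submodule.subset_span
      ⟨d.1, d.2, hd0, hasBidegree_polyOp bidegree_eq_of_mem_support_filter⟩
  · have hmem : polyOp U (G.filter (bidegree · = d)) ∈ opsOn U (stairs r p q) :=
      polyOp_mem_opsOn fun t ht => by
        rw [Finsupp.support_filter] at ht
        exact (hG t (Finset.filter_subset _ _ ht)).1
    rw [opsOn_ext (stairs_isLowerSet r p q) hmem (zero_mem _) fun e he =>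
      polyOp_filter_mon_eq_zero hU hd (not_le.1 hd0) (hy e he)]
    exact Submodule.zero_mem _

theorem notMem_complementDown_of_hasBidegree (hU : (U : Set (ℂ × ℂ)).Nonempty)
    (hT0 : T ≠ 0) {a b : ℤ} (hb : 0 < b) (h : HasBidegree T a b) :
    T ∉ complementDown U r p q := fun hT =>
  hT0 (opsOn_ext (stairs_isLowerSet r p q) hT.1.2 (zero_mem _) fun e _ =>
    eq_zero_of_mem_span_disjoint hU (disjoint_translate_of_pos (d := (a, b)) hb e)
      ((hasBidegree_iff.1 h).2 e) (apply_mon_mem_yDegreeLE hT e))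

end ComplementDown

/-- The algebra of operators that do not raise the `y`-degree of polynomials. -/
def yNonraising (U : Opens (ℂ × ℂ)) : Subalgebra ℂ (Module.End ℂ (Smooth U)) where
  carrier := {T | ∀ n, ∀ u ∈ yDegreeLE U n, T u ∈ yDegreeLE U n}
  mul_mem' hS hT n u hu := hS n _ (hT n u hu)
  add_mem' hS hT n u hu := Submodule.add_mem _ (hS n u hu) (hT n u hu)
  algebraMap_mem' c _ _ hu := Submodule.smul_mem _ c hu

theorem mem_yNonraising_iff {T : Module.End ℂ (Smooth U)} :
    T ∈ yNonraising U ↔ ∀ e, T (mon U e) ∈ yDegreeLE U e.2 := by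
  refine ⟨fun hT e => hT e.2 _ (mon_mem_yDegreeLE le_rfl), fun hT n => ?_⟩
  have hle : yDegreeLE U n ≤ (yDegreeLE U n).comap T := by
    refine Submodule.span_le.2 ?_
    rintro _ ⟨m, hm, rfl⟩
    exact yDegreeLE_mono hm (hT m)
  exact fun u hu => hle hu

theorem X_pow_mul_mon (n i j : ℕ) : X U ^ n * mon U (i, j) = mon U (i + n, j) := by
  simp only [mon]
  ring

theorem mulOp_X_mul_Dx_mon (i j : ℕ) :
    (mulOp (X U) * Dx U) (mon U (i, j)) = (i : ℂ) • mon U (i, j) := by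
  rw [Module.End.mul_apply, Dx_mon, map_smul, LinearMap.mulLeft_apply]
  rcases i with _ | i
  · simp
  · rw [← pow_one (X U), X_pow_mul_mon]
    rfl

theorem mulOp_Y_mul_Dy_mon (i j : ℕ) :
    (mulOp (Y U) * Dy U) (mon U (i, j)) = (j : ℂ) • mon U (i, j) := by
  rw [Module.End.mul_apply, Dy_mon, map_smul, LinearMap.mulLeft_apply]
  rcases j with _ | j
  · simp
  · simp only [mon, Nat.add_sub_cancel, pow_succ (Y U)]
    ring_nf

theorem genAux_one_mon (r p i j : ℕ) : genAux U r p 1 (mon U (i, j)) =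
    ((i : ℂ) + r * j - p) • mon U (i + 1, j) := by
  have hfactor : genAux U r p 1 = mulOp (X U) *
      (mulOp (X U) * Dx U + (r : ℂ) • (mulOp (Y U) * Dy U) - (p : ℂ) • 1) := by
    refine LinearMap.ext fun u => ?_
    simp [genAux, pow_two, mul_sub, mul_add]
  have hX : X U * mon U (i, j) = mon U (i + 1, j) := by
    rw [← X_pow_mul_mon, pow_one]
  rw [hfactor, Module.End.mul_apply, LinearMap.sub_apply, LinearMap.add_apply,
    LinearMap.smul_apply, LinearMap.smul_apply, mulOp_X_mul_Dx_mon, mulOp_Y_mul_Dy_mon,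
    Module.End.one_apply, smul_smul, ← add_smul, ← sub_smul, map_smul, LinearMap.mulLeft_apply, hX]

theorem genAux_two_mon (r p i j : ℕ) : genAux U r p 2 (mon U (i, j)) =
    ((i : ℂ) - p / 2) • mon U (i, j) := by
  rw [genAux, LinearMap.sub_apply, mulOp_X_mul_Dx_mon, LinearMap.smul_apply, Module.End.one_apply,
    ← sub_smul]

theorem genAux_add_four_mon (r p s i j : ℕ) : genAux U r p (s + 4) (mon U (i, j)) =
    (j : ℂ) • mon U (i + s, j - 1) := by
  rw [genAux, Module.End.mul_apply, Dy_mon, map_smul, LinearMap.mulLeft_apply, X_pow_mul_mon]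

theorem gen_mem_yNonraising (r p : ℕ) (s : Fin (r + 5)) : gen U r p s ∈ yNonraising U := by
  rw [mem_yNonraising_iff]
  rintro ⟨i, j⟩
  change genAux U r p s (mon U (i, j)) ∈ _
  match (s : ℕ) with
  | 0 =>
    rw [genAux, Dx_mon]
    exact Submodule.smul_mem _ _ (mon_mem_yDegreeLE le_rfl)
  | 1 =>
    rw [genAux_one_mon]
    exact Submodule.smul_mem _ _ (mon_mem_yDegreeLE le_rfl)
  | 2 =>
    rw [genAux_two_mon]
    exact Submodule.smul_mem _ _ (mon_mem_yDegreeLE le_rfl)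
  | 3 =>
    rw [genAux, mulOp_Y_mul_Dy_mon]
    exact Submodule.smul_mem _ _ (mon_mem_yDegreeLE le_rfl)
  | s + 4 =>
    rw [genAux_add_four_mon]
    exact Submodule.smul_mem _ _ (mon_mem_yDegreeLE (Nat.sub_le _ _))

theorem IsLieAlgebraic.mem_complementDown (hU : (U : Set (ℂ × ℂ)).Nonempty) {r p q : ℕ}
    {T : Module.End ℂ (Smooth U)} (h : IsLieAlgebraic U r p q T) (hT : T ∈ complement U r p q) :
    T ∈ complementDown U r p q := by
  obtain ⟨P, hP, N, hN, rfl⟩ := h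
  have hadjoin : Algebra.adjoin ℂ (Set.range (gen U r p)) ≤ yNonraising U :=
    Algebra.adjoin_le (Set.range_subset_iff.2 (gen_mem_yNonraising r p))
  refine (mem_complementDown_iff hU).2 ⟨hT, fun e he => ?_⟩
  rw [LinearMap.add_apply, (mem_kerRestrict_iff.1 hN).2 e he, add_zero]
  exact mem_yNonraising_iff.1 (hadjoin hP) e

/-! ### Realization by the generators -/

theorem exists_fall_eq_mul_eval {k₀ k : ℕ × ℕ} (h : k₀ ≤ k) :
    ∃ Φ : MvPolynomial (Fin 2) ℂ, Φ.totalDegree + (k₀.1 + k₀.2) ≤ k.1 + k.2 ∧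
      ∀ i j : ℕ, fall k (i, j) =
        fall k₀ (i, j) * MvPolynomial.eval ![(i : ℂ), (j : ℂ)] Φ := by
  obtain ⟨h₁, h₂⟩ := Prod.le_def.1 h
  obtain ⟨Φ₁, hdeg₁, hval₁⟩ := exists_descFactorial_eq_mul_eval ℂ (0 : Fin 2) h₁
  obtain ⟨Φ₂, hdeg₂, hval₂⟩ := exists_descFactorial_eq_mul_eval ℂ (1 : Fin 2) h₂
  refine ⟨Φ₁ * Φ₂, by have := MvPolynomial.totalDegree_mul Φ₁ Φ₂; omega, fun i j => ?_⟩
  have hx : (fun t => ((![i, j] t : ℕ) : ℂ)) = ![(i : ℂ), (j : ℂ)] := by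
    ext t
    fin_cases t <;> rfl
  have hi := hval₁ ![i, j]
  have hj := hval₂ ![i, j]
  rw [hx] at hi hj
  simp only [Matrix.cons_val_zero, Matrix.cons_val_one] at hi hj
  rw [fall, fall, hi, hj, map_mul]
  ring

theorem exists_symb_eq_fall_mul_eval {G : (ℕ × ℕ) × (ℕ × ℕ) →₀ ℂ} (hG : G.support.Nonempty)
    {k₀ : ℕ × ℕ} {K : ℕ} (hk₀ : ∀ t ∈ G.support, k₀ ≤ t.1)
    (hK : ∀ t ∈ G.support, t.1.1 + t.1.2 ≤ K) :
    ∃ Φ : MvPolynomial (Fin 2) ℂ, Φ.totalDegree + (k₀.1 + k₀.2) ≤ K ∧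
      ∀ i j : ℕ, symb G (i, j) = fall k₀ (i, j) * MvPolynomial.eval ![(i : ℂ), (j : ℂ)] Φ := by
  choose! Φ hdeg hval using fun t ht => exists_fall_eq_mul_eval (hk₀ t ht)
  refine ⟨∑ t ∈ G.support, MvPolynomial.C (G t) * Φ t, ?_, fun i j => ?_⟩
  · obtain ⟨t₀, ht₀⟩ := hG
    have hle : k₀.1 + k₀.2 ≤ K := by
      have := hdeg t₀ ht₀
      have := hK t₀ ht₀
      omega
    refine Nat.add_le_of_le_sub hle (MvPolynomial.totalDegree_finsetSum_le fun t ht => ?_)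
    have hmul := MvPolynomial.totalDegree_mul (MvPolynomial.C (G t)) (Φ t)
    rw [MvPolynomial.totalDegree_C] at hmul
    have := hdeg t ht
    have := hK t ht
    omega
  · rw [symb, Finsupp.sum, map_sum, Finset.mul_sum]
    refine Finset.sum_congr rfl fun t ht => ?_
    rw [hval t ht, map_mul, MvPolynomial.eval_C]
    ring

section Realization

variable {r p : ℕ}

theorem evalGen_eq_constr (P : MvPolynomial (Fin (r + 5)) ℂ) :
    evalGen U r p P = (MvPolynomial.basisMonomials (Fin (r + 5)) ℂ).constr ℂ
      (fun K => (List.ofFn fun s => gen U r p s ^ K s).prod) P := by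
  rw [Module.Basis.constr_apply]
  rfl

theorem evalGen_sum {ι : Type*} (s : Finset ι) (P : ι → MvPolynomial (Fin (r + 5)) ℂ) :
    evalGen U r p (∑ t ∈ s, P t) = ∑ t ∈ s, evalGen U r p (P t) := by
  simp only [evalGen_eq_constr, map_sum]

theorem evalGen_monomial (K : Fin (r + 5) →₀ ℕ) (c : ℂ) :
    evalGen U r p (MvPolynomial.monomial K c) =
      c • (List.ofFn fun s => gen U r p s ^ K s).prod := by
  have hmonomial : MvPolynomial.monomial K c =
      c • MvPolynomial.basisMonomials (Fin (r + 5)) ℂ K := by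
    rw [MvPolynomial.coe_basisMonomials, MvPolynomial.smul_monomial, smul_eq_mul, mul_one]
  rw [evalGen_eq_constr, hmonomial, map_smul, Module.Basis.constr_basis]

theorem genAux_one_pow_mon (d i j : ℕ) : (genAux U r p 1 ^ d) (mon U (i, j)) =
    (ascPochhammer ℂ d).eval (i + r * j - p : ℂ) • mon U (i + d, j) := by
  induction d with
  | zero => simp
  | succ d ih =>
    rw [pow_succ', Module.End.mul_apply, ih, map_smul, genAux_one_mon, smul_smul,
      ascPochhammer_succ_eval, add_assoc]
    congr 2
    push_cast
    ring

theorem genAux_add_four_pow_mon (s l i j : ℕ) : (genAux U r p (s + 4) ^ l) (mon U (i, j)) =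
    (j.descFactorial l : ℂ) • mon U (i + s * l, j - l) := by
  induction l with
  | zero => simp
  | succ l ih =>
    rw [pow_succ', Module.End.mul_apply, ih, map_smul, genAux_add_four_mon, smul_smul,
      Nat.descFactorial_succ, Nat.sub_sub, add_assoc, ← Nat.mul_succ, Nat.cast_mul, mul_comm]

theorem prod_ofFn_genAux_add_four_pow_mon {n : ℕ} (c L : Fin n → ℕ) (i j : ℕ) :
    (List.ofFn fun s => genAux U r p (c s + 4) ^ L s).prod (mon U (i, j)) =
      (j.descFactorial (∑ s, L s) : ℂ) • mon U (i + ∑ s, c s * L s, j - ∑ s, L s) := by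
  induction n with
  | zero => simp
  | succ n ih =>
    rw [List.ofFn_succ, List.prod_cons, Module.End.mul_apply, ih, map_smul,
      genAux_add_four_pow_mon, smul_smul, Fin.sum_univ_succ, Fin.sum_univ_succ,
      ← Nat.descFactorial_mul_descFactorial (Nat.le_add_left (∑ s : Fin n, L s.succ) (L 0)),
      Nat.add_sub_cancel, Nat.cast_mul, mul_comm, Nat.sub_sub, add_assoc, add_comm (L 0),
      add_comm (c 0 * L 0)]

/-- The exponents of the generator monomial
`(J¹)^α (J²)^d (J³)^m (J⁴)^n (J⁵)^(L 0) ⋯ (J^(5+r))^(L r)`. -/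
def genExponent (α d m n : ℕ) (L : Fin (r + 1) → ℕ) : Fin (r + 5) →₀ ℕ :=
  Finsupp.equivFunOnFinite.symm
    (Fin.cons α (Fin.cons d (Fin.cons m (Fin.cons n L))) : Fin (r + 1 + 1 + 1 + 1 + 1) → ℕ)

theorem degree_genExponent (α d m n : ℕ) (L : Fin (r + 1) → ℕ) :
    ∑ s, genExponent α d m n L s = α + (d + (m + (n + ∑ s, L s))) := by
  simp [genExponent, Fin.sum_univ_succ (n := r + 4), Fin.sum_univ_succ (n := r + 3),
    Fin.sum_univ_succ (n := r + 2), Fin.sum_univ_succ (n := r + 1)]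

theorem prod_ofFn_gen_pow_mon (α d m n : ℕ) (L : Fin (r + 1) → ℕ) (i j : ℕ) {a β : ℕ}
    (hβ : ∑ s, L s = β) (ha : ∑ s : Fin (r + 1), (s : ℕ) * L s = a) :
    (List.ofFn fun s => gen U r p s ^ genExponent α d m n L s).prod (mon U (i, j)) =
      (((i + a + d).descFactorial α : ℂ) *
        (ascPochhammer ℂ d).eval ((i + a : ℕ) + r * (j - β : ℕ) - p : ℂ) *
        (((i + a : ℕ) - p / 2 : ℂ) ^ m * ((j - β : ℕ) : ℂ) ^ n) * j.descFactorial β) •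
      mon U (i + a + d - α, j - β) := by
  have hfactor : (List.ofFn fun s => gen U r p s ^ genExponent α d m n L s) =
      Dx U ^ α :: genAux U r p 1 ^ d :: genAux U r p 2 ^ m :: genAux U r p 3 ^ n ::
        List.ofFn fun s => genAux U r p (s + 4) ^ L s := by
    simp only [List.ofFn_succ (n := r + 4), List.ofFn_succ (n := r + 3),
      List.ofFn_succ (n := r + 2), List.ofFn_succ (n := r + 1)]
    rfl
  have hy := pow_apply_of_apply_eq_smul (T := genAux U r p 3) (mulOp_Y_mul_Dy_mon (i + a) (j - β)) n
  have hx := pow_apply_of_apply_eq_smul (genAux_two_mon (U := U) r p (i + a) (j - β)) m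
  rw [hfactor]
  simp only [List.prod_cons, Module.End.mul_apply, prod_ofFn_genAux_add_four_pow_mon, hβ, ha,
    map_smul, hy, hx, genAux_one_pow_mon, Dx_pow_mon, smul_smul]
  congr 1
  ring

theorem exists_evalGen_mon_eq_eigenvalue (U : Opens (ℂ × ℂ)) {α d a β k : ℕ} (ha : a ≤ r * β)
    {ψ : MvPolynomial (Fin 2) ℂ} (hψ : ψ = 0 ∨ ψ.totalDegree + (α + d + β) ≤ k) :
    ∃ P : MvPolynomial (Fin (r + 5)) ℂ, P.totalDegree ≤ k ∧
      ∀ i j : ℕ, evalGen U r p P (mon U (i, j)) =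
        (((i + a + d).descFactorial α : ℂ) *
          (ascPochhammer ℂ d).eval ((i + a : ℕ) + r * (j - β : ℕ) - p : ℂ) *
          MvPolynomial.eval ![((i + a : ℕ) - p / 2 : ℂ), ((j - β : ℕ) : ℂ)] ψ *
            j.descFactorial β) •
        mon U (i + a + d - α, j - β) := by
  obtain ⟨L, hL, hLa⟩ := exists_sum_eq_sum_mul_eq ha
  refine ⟨∑ v ∈ ψ.support, MvPolynomial.monomial (genExponent α d (v 0) (v 1) L) (ψ.coeff v),
    ?_, fun i j => ?_⟩
  · refine MvPolynomial.totalDegree_finsetSum_le fun v hv =>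
      (MvPolynomial.totalDegree_monomial_le _ _).trans ?_
    have hψ0 : ψ ≠ 0 := MvPolynomial.ne_zero_iff.2 ⟨v, MvPolynomial.mem_support_iff.1 hv⟩
    have hψdeg := hψ.resolve_left hψ0
    have hdeg := MvPolynomial.le_totalDegree hv
    rw [Finsupp.sum_fintype _ _ fun _ => rfl, Fin.sum_univ_two] at hdeg
    rw [Finsupp.sum_fintype _ _ fun _ => rfl, show ∑ s, id _ = _ from degree_genExponent .., hL]
    omega
  · rw [evalGen_sum, LinearMap.sum_apply, MvPolynomial.eval_eq', Finset.mul_sum, Finset.sum_mul,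
      Finset.sum_smul]
    refine Finset.sum_congr rfl fun v _ => ?_
    rw [evalGen_monomial, LinearMap.smul_apply, prod_ofFn_gen_pow_mon α d _ _ L i j hL hLa,
      smul_smul, Fin.prod_univ_two]
    congr 1
    simp only [Matrix.cons_val_zero, Matrix.cons_val_one]
    ring

theorem exists_evalGen_mon_eq (U : Opens (ℂ × ℂ)) {α d a β k : ℕ} (ha : a ≤ r * β)
    {ψ : MvPolynomial (Fin 2) ℂ} (hψ : ψ = 0 ∨ ψ.totalDegree + (α + d + β) ≤ k) :
    ∃ P : MvPolynomial (Fin (r + 5)) ℂ, P.totalDegree ≤ k ∧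
      ∀ i j : ℕ, evalGen U r p P (mon U (i, j)) =
        (((i + a + d).descFactorial α : ℂ) *
          (ascPochhammer ℂ d).eval (i + a + r * (j - β) - p : ℂ) *
          MvPolynomial.eval ![(i : ℂ), (j : ℂ)] ψ * j.descFactorial β) •
        mon U (i + a + d - α, j - β) := by
  let shift : Fin 2 → MvPolynomial (Fin 2) ℂ :=
    ![MvPolynomial.X 0 - MvPolynomial.C (a - p / 2 : ℂ),
      MvPolynomial.X 1 - MvPolynomial.C (-β : ℂ)]
  have hshift : ∀ s, (shift s).totalDegree ≤ 1 := by
    intro s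
    fin_cases s <;>
      exact (MvPolynomial.totalDegree_sub_C_le _ _).trans_eq (MvPolynomial.totalDegree_X _)
  obtain ⟨P, hdeg, hP⟩ := exists_evalGen_mon_eq_eigenvalue (p := p) (α := α) (d := d) U ha
    (hψ.imp (fun h => (congrArg (MvPolynomial.aeval shift) h).trans (map_zero _))
      (Nat.add_le_add_right (totalDegree_aeval_le hshift ψ) _).trans)
  refine ⟨P, hdeg, fun i j => ?_⟩
  rcases lt_or_ge j β with hj | hj
  · simp only [hP, Nat.descFactorial_of_lt hj, Nat.cast_zero, mul_zero, zero_smul]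
  have heval : MvPolynomial.eval ![((i + a : ℕ) - p / 2 : ℂ), ((j - β : ℕ) : ℂ)]
      (MvPolynomial.aeval shift ψ) = MvPolynomial.eval ![(i : ℂ), (j : ℂ)] ψ := by
    rw [← MvPolynomial.aeval_eq_eval, ← MvPolynomial.aeval_eq_eval, ← AlgHom.comp_apply]
    refine DFunLike.congr_fun (MvPolynomial.algHom_ext fun s => ?_) ψ
    rw [AlgHom.comp_apply, MvPolynomial.aeval_X, MvPolynomial.aeval_X]
    fin_cases s <;> simp [shift, Nat.cast_sub hj]
  rw [hP, heval, Nat.cast_sub hj, Nat.cast_add]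

section Component

variable {q k α β d a : ℕ} {x : ℤ} {G : (ℕ × ℕ) × (ℕ × ℕ) →₀ ℂ}

theorem exists_symb_eq_fall_mul_ascPochhammer_mul_eval (hU : (U : Set (ℂ × ℂ)).Nonempty)
    (hG : ∀ t ∈ G.support, bidegree t = (x, -(β : ℤ))) (hk : ∀ t ∈ G.support, t.1.1 + t.1.2 ≤ k)
    (h : ∀ e ∈ stairs r p q, polyOp U G (mon U e) ∈ Submodule.span ℂ (mon U '' stairs r p q))
    (hx : (a + d - α : ℤ) = x) (hα : α = 0 ∨ a + d = 0) (hd : d = 0 ∨ a = r * β) :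
    ∃ ψ : MvPolynomial (Fin 2) ℂ, (ψ = 0 ∨ ψ.totalDegree + (α + d + β) ≤ k) ∧
      ∀ i j : ℕ, (i, j) ∈ stairs r p q → (α, β) ≤ (i, j) → symb G (i, j) =
        fall (α, β) (i, j) * (ascPochhammer ℂ d).eval (i + r * j - p : ℂ) *
          MvPolynomial.eval ![(i : ℂ), (j : ℂ)] ψ := by
  have hle : ∀ t ∈ G.support, (α, β) ≤ t.1 := fun t ht => by
    have := Prod.ext_iff.1 (hG t ht)
    simp only [bidegree] at this
    exact Prod.le_def.2 ⟨by dsimp only; omega, by dsimp only; omega⟩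
  rcases G.support.eq_empty_or_nonempty with hne | hne
  · exact ⟨0, Or.inl rfl, fun i j _ _ => by simp [Finsupp.support_eq_empty.1 hne, symb]⟩
  obtain ⟨Φ, hΦdeg, hΦ⟩ := exists_symb_eq_fall_mul_eval hne hle hk
  obtain ⟨ψ, hψdeg, hψ⟩ := exists_eval_eq_ascPochhammer_mul (r := r) (p := p) (d := d)
    (Q := {j | β ≤ j ∧ j ≤ q}) (F := Φ) fun i j hj hp hpd => by
      have hα0 : α = 0 := by omega
      have ha : a = r * β := by omega
      subst hα0 ha
      have hm : (i + (r * β + d), j - β) ∈ translate (i, j) (x, -(β : ℤ)) := by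
        simp only [translate, Set.mem_ofPred_eq, ← hx]
        have := hj.1
        omega
      have hmS : (i + (r * β + d), j - β) ∉ stairs r p q := fun hmS => by
        have := hmS.1
        simp only [Nat.mul_sub] at this
        have := Nat.mul_le_mul_left r hj.1
        omega
      have h0 := symb_eq_zero_of_notMem hU hG hm hmS (h (i, j) ⟨hp, hj.2⟩)
      rw [hΦ, mul_eq_zero, fall_eq_zero_iff, Prod.mk_le_mk] at h0
      exact h0.resolve_left (not_not.2 ⟨Nat.zero_le _, hj.1⟩)
  refine ⟨ψ, hψdeg.imp_right fun hψdeg => by dsimp only at hΦdeg; omega, fun i j hS hij => ?_⟩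
  rw [hΦ, hψ i j ⟨(Prod.mk_le_mk.1 hij).2, hS.2⟩ hS.1, mul_assoc]

theorem exists_evalGen_eq_on_stairs_of_bidegree (hU : (U : Set (ℂ × ℂ)).Nonempty)
    (hG : ∀ t ∈ G.support, bidegree t = (x, -(β : ℤ)))
    (hk : ∀ t ∈ G.support, t.1.1 + t.1.2 ≤ k)
    (h : ∀ e ∈ stairs r p q, polyOp U G (mon U e) ∈ Submodule.span ℂ (mon U '' stairs r p q)) :
    ∃ P : MvPolynomial (Fin (r + 5)) ℂ, P.totalDegree ≤ k ∧
      ∀ e ∈ stairs r p q, evalGen U r p P (mon U e) = polyOp U G (mon U e) := by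
  obtain ⟨α, d, a, hx, haβ, hα, hd⟩ := exists_shift_decomposition r β x
  obtain ⟨ψ, hψdeg, hψ⟩ := exists_symb_eq_fall_mul_ascPochhammer_mul_eval hU hG hk h hx hα hd
  obtain ⟨P, hPdeg, hP⟩ := exists_evalGen_mon_eq (p := p) U haβ hψdeg
  refine ⟨P, hPdeg, fun ⟨i, j⟩ hS => ?_⟩
  have hdesc : (i + a + d).descFactorial α = i.descFactorial α := by
    rcases hα with rfl | hα
    · rfl
    · rw [add_assoc, hα, add_zero]
  have hasc : (ascPochhammer ℂ d).eval (i + a + r * (j - β) - p : ℂ) =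
      (ascPochhammer ℂ d).eval (i + r * j - p : ℂ) := by
    rcases hd with rfl | rfl
    · simp
    · congr 1
      push_cast
      ring
  have hcoeff (c c' : ℂ) : (i.descFactorial α : ℂ) * c * c' * j.descFactorial β =
      fall (α, β) (i, j) * c * c' := by
    rw [fall]
    ring
  rw [hP, hdesc, hasc, hcoeff]
  by_cases hij : (α, β) ≤ (i, j)
  · have hm : (i + a + d - α, j - β) ∈ translate (i, j) (x, -(β : ℤ)) := by
      have := Prod.mk_le_mk.1 hij
      simp only [translate, Set.mem_ofPred_eq, ← hx]
      omega
    rw [polyOp_mon_of_mem_translate hG hm, hψ i j hS hij]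
  · have hempty : translate (i, j) (x, -(β : ℤ)) = ∅ := by
      refine Set.eq_empty_of_forall_notMem fun m hm => hij ?_
      simp only [translate, Set.mem_ofPred_eq, ← hx] at hm
      exact Prod.mk_le_mk.2 ⟨by omega, by omega⟩
    have hzero := polyOp_mon_mem_span_translate (U := U) hG (i, j)
    rw [hempty, Set.image_empty, Submodule.span_empty, Submodule.mem_bot] at hzero
    rw [hzero, fall_eq_zero_iff.2 hij, zero_mul, zero_mul, zero_smul]

end Component

end Realization

section Projection

variable {r p q k : ℕ} {P T : Module.End ℂ (Smooth U)}

theorem IsProjection.mem_opsOfOrderLE (h : IsProjection U r p q P T)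
    (hP : P ∈ opsOfOrderLE U k) : T ∈ opsOfOrderLE U k := by
  obtain ⟨P', hP', heq⟩ := exists_truncation (stairs_isLowerSet r p q) hP
  rw [opsOn_inter (stairs_isLowerSet r p q)] at hP'
  have hP'T : IsProjection U r p q P' T :=
    isProjection_of_eq_on_stairs (opsOn_mono (Set.subset_univ _) hP'.1) h.2.1 fun e he => by
      rw [heq e he, ← sub_eq_zero, ← LinearMap.sub_apply]
      exact (mem_kerRestrict_iff.1 h.2.2).2 e he
  exact hP'T.eq hP'.1 ▸ hP'.2

theorem exists_evalGen_eq_on_stairs (hU : (U : Set (ℂ × ℂ)).Nonempty)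
    (hT : T ∈ complementDown U r p q) (hTk : T ∈ opsOfOrderLE U k) :
    ∃ P : MvPolynomial (Fin (r + 5)) ℂ, P.totalDegree ≤ k ∧
      ∀ e ∈ stairs r p q, evalGen U r p P (mon U e) = T (mon U e) := by
  obtain ⟨G, hG, rfl⟩ := exists_polyOp_eq_of_mem_complement hT.1 hTk
  have hcomponent : ∀ d ∈ G.support.image bidegree, ∃ P : MvPolynomial (Fin (r + 5)) ℂ,
      P.totalDegree ≤ k ∧ ∀ e ∈ stairs r p q,
        evalGen U r p P (mon U e) = polyOp U (G.filter (bidegree · = d)) (mon U e) := by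
    intro d hd
    rcases lt_or_ge 0 d.2 with hd0 | hd0
    · refine ⟨0, by simp, fun e _ => ?_⟩
      rw [polyOp_filter_mon_eq_zero hU hd hd0 (apply_mon_mem_yDegreeLE hT e)]
      simp [evalGen]
    · have hdβ : d = (d.1, -((-d.2).toNat : ℤ)) := Prod.ext rfl (by dsimp only; omega)
      refine exists_evalGen_eq_on_stairs_of_bidegree hU
        (fun t ht => (bidegree_eq_of_mem_support_filter t ht).trans hdβ) (fun t ht => ?_)
        fun e he => polyOp_filter_mon_mem_span hU hd (hT.1.1.2 _ (mon_mem_stairModule he))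
      rw [Finsupp.support_filter] at ht
      exact (hG t (Finset.filter_subset _ _ ht)).2
  choose! P hdeg hP using hcomponent
  refine ⟨∑ d ∈ G.support.image bidegree, P d, MvPolynomial.totalDegree_finsetSum_le hdeg,
    fun e he => ?_⟩
  rw [polyOp_eq_sum_filter, evalGen_sum, LinearMap.sum_apply, LinearMap.sum_apply]
  exact Finset.sum_congr rfl fun d hd => hP d hd e he

theorem exists_isProjection_evalGen (hU : (U : Set (ℂ × ℂ)).Nonempty)
    (hT : T ∈ complementDown U r p q) (hTk : T ∈ opsOfOrderLE U k) :
    ∃ P : MvPolynomial (Fin (r + 5)) ℂ, P.totalDegree ≤ k ∧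
      ((∀ m < k, T ∉ opsOfOrderLE U m) → P.totalDegree = k) ∧
      IsProjection U r p q (evalGen U r p P) T := by
  obtain ⟨P, hdeg, hP⟩ := exists_evalGen_eq_on_stairs hU hT hTk
  have hPT : IsProjection U r p q (evalGen U r p P) T := isProjection_of_eq_on_stairs
    (opsOn_mono (Set.subset_univ _) (evalGen_mem_opsOfOrderLE r p P)) hT.1 hP
  refine ⟨P, hdeg, fun hmin => hdeg.eq_of_not_lt fun hlt => ?_, hPT⟩
  exact hmin _ hlt (hPT.mem_opsOfOrderLE (evalGen_mem_opsOfOrderLE r p P))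

theorem opsOfOrderLE_le_opsOn_stairs (hkp : k ≤ p) (hkq : k ≤ q) (hrk : r * k ≤ p) :
    opsOfOrderLE U k ≤ opsOn U (stairs r p q) := by
  refine opsOn_mono fun e (he : e.1 + e.2 ≤ k) => ⟨?_, by omega⟩
  rcases Nat.eq_zero_or_pos r with rfl | hr
  · omega
  · calc e.1 + r * e.2 ≤ r * e.1 + r * e.2 := by gcongr; exact Nat.le_mul_of_pos_left _ hr
      _ = r * (e.1 + e.2) := (mul_add _ _ _).symm
      _ ≤ r * k := Nat.mul_le_mul_left r he
      _ ≤ p := hrk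

end Projection

section Example

theorem mulOp_Y_mul_Dx_pow_mon (r i j : ℕ) : (mulOp (Y U) * Dx U ^ r) (mon U (i, j)) =
    (i.descFactorial r : ℂ) • mon U (i - r, j + 1) := by
  rw [Module.End.mul_apply, Dx_pow_mon, map_smul, LinearMap.mulLeft_apply]
  congr 1
  simp only [mon]
  ring

theorem mulOp_Y_mul_Dx_pow_eq (r : ℕ) :
    mulOp (Y U) * Dx U ^ r = mulOp (mon U (0, 1)) * diffMon U (r, 0) := by
  simp [mon, diffMon]

theorem hasBidegree_mulOp_Y_mul_Dx_pow (U : Opens (ℂ × ℂ)) (r : ℕ) :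
    HasBidegree (mulOp (Y U) * Dx U ^ r) (-r) 1 := by
  refine hasBidegree_iff.2 ⟨?_, fun ⟨i, j⟩ => ?_⟩
  · rw [mulOp_Y_mul_Dx_pow_eq]
    exact isPolyOp_mulOp_mul_diffMon (mon_mem_adjoin _) _
  rw [mulOp_Y_mul_Dx_pow_mon]
  rcases lt_or_ge i r with hi | hi
  · rw [Nat.descFactorial_of_lt hi, Nat.cast_zero, zero_smul]
    exact Submodule.zero_mem _
  · refine Submodule.smul_mem _ _ (Submodule.subset_span (Set.mem_image_of_mem _ ?_))
    simp only [translate, Set.mem_ofPred_eq]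
    omega

theorem mulOp_Y_mul_Dx_pow_ne_zero (hU : (U : Set (ℂ × ℂ)).Nonempty) (r : ℕ) :
    mulOp (Y U) * Dx U ^ r ≠ 0 := fun h => by
  have hmon := mulOp_Y_mul_Dx_pow_mon (U := U) r r 0
  rw [h, LinearMap.zero_apply, Nat.descFactorial_self, eq_comm, smul_eq_zero] at hmon
  exact hmon.elim (Nat.cast_ne_zero.2 r.factorial_ne_zero) ((mon_linearIndependent hU).ne_zero _)

theorem mulOp_Y_mul_Dx_pow_mem_complement (U : Opens (ℂ × ℂ)) {r p q : ℕ} (hrp : r ≤ p)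
    (hpq : p < r * (q + 1)) : mulOp (Y U) * Dx U ^ r ∈ complement U r p q := by
  have hmem : mulOp (Y U) * Dx U ^ r ∈ opsOn U (stairs r p q) := by
    rw [mulOp_Y_mul_Dx_pow_eq]
    have hstairs : (r, 0) ∈ stairs r p q := ⟨by simpa using hrp, Nat.zero_le _⟩
    exact mulOp_mul_diffMon_mem_opsOn hstairs _
  refine ⟨mem_preserving_iff.2 ⟨opsOn_mono (Set.subset_univ _) hmem, fun ⟨i, j⟩ hij => ?_⟩, hmem⟩
  rw [mulOp_Y_mul_Dx_pow_mon]
  rcases lt_or_ge i r with hi | hi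
  · rw [Nat.descFactorial_of_lt hi, Nat.cast_zero, zero_smul]
    exact Submodule.zero_mem _
  · have hp : i + r * j ≤ p := hij.1
    have hj : r * (j + 1) < r * (q + 1) := by
      rw [Nat.mul_succ r j]
      omega
    refine Submodule.smul_mem _ _ (mon_mem_stairModule ⟨?_, ?_⟩)
    · dsimp only
      rw [Nat.mul_succ r j]
      omega
    · exact Nat.lt_succ_iff.1 (Nat.lt_of_mul_lt_mul_left hj)

end Example

end Staircase

end

open Staircase in
theorem mainTheorem4_general (U : TopologicalSpace.Opens (ℂ × ℂ))
    (hU : (U : Set (ℂ × ℂ)).Nonempty) (r p q : ℕ) :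
    (Disjoint (complement U r p q) (kerRestrict U r p q) ∧
      complement U r p q ⊔ kerRestrict U r p q = preserving U r p q) ∧
    (∀ k : ℕ, k ≤ p → k ≤ q → r * k ≤ p → ∀ T ∈ complementDown U r p q, T ∈ opsOfOrderLE U k →
      ∃ P : MvPolynomial (Fin (r + 5)) ℂ, P.totalDegree ≤ k ∧
        ((∀ m < k, T ∉ opsOfOrderLE U m) → P.totalDegree = k) ∧
        evalGen U r p P = T) ∧
    (∀ k : ℕ, ∀ T ∈ complementDown U r p q, T ∈ opsOfOrderLE U k →
      ∃ P : MvPolynomial (Fin (r + 5)) ℂ, P.totalDegree ≤ k ∧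
        ((∀ m < k, T ∉ opsOfOrderLE U m) → P.totalDegree = k) ∧
        IsProjection U r p q (evalGen U r p P) T) ∧
    (∀ T ∈ complement U r p q, T ∉ complementDown U r p q → ¬ IsLieAlgebraic U r p q T) ∧
    (∀ T ∈ complement U r p q, T ≠ 0 → ∀ a b : ℤ, 0 < b → HasBidegree T a b →
      ¬ IsLieAlgebraic U r p q T) ∧
    (r ≤ p → p < r * (q + 1) →
      mulOp (Y U) * Dx U ^ r ∈ complement U r p q ∧
      HasBidegree (mulOp (Y U) * Dx U ^ r) (-r) 1 ∧
      ¬ IsLieAlgebraic U r p q (mulOp (Y U) * Dx U ^ r)) := by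
  have hnotLie : ∀ T ∈ complement U r p q, T ≠ 0 → ∀ a b : ℤ, 0 < b → HasBidegree T a b →
      ¬ IsLieAlgebraic U r p q T := fun T hT hT0 a b hb hab hLie =>
    notMem_complementDown_of_hasBidegree hU hT0 hb hab (hLie.mem_complementDown hU hT)
  refine ⟨⟨disjoint_complement_kerRestrict U r p q, complement_sup_kerRestrict U r p q⟩,
    fun k hkp hkq hrk T hT hTk => ?_, fun k T hT hTk => exists_isProjection_evalGen hU hT hTk,
    fun T hT hTdown hLie => hTdown (hLie.mem_complementDown hU hT), hnotLie, fun hrp hpq => ?_⟩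
  · obtain ⟨P, hdeg, hexact, hP⟩ := exists_isProjection_evalGen hU hT hTk
    exact ⟨P, hdeg, hexact, hP.eq (opsOfOrderLE_le_opsOn_stairs hkp hkq hrk
      (opsOfOrderLE_mono hdeg (evalGen_mem_opsOfOrderLE r p P)))⟩
  · have hmem := mulOp_Y_mul_Dx_pow_mem_complement U hrp hpq
    have hdeg := hasBidegree_mulOp_Y_mul_Dx_pow U r
    exact ⟨hmem, hdeg, hnotLie _ hmem (mulOp_Y_mul_Dx_pow_ne_zero hU r) _ _ one_pos hdeg⟩

open Staircase in
theorem mainTheorem4 (U : TopologicalSpace.Opens (ℂ × ℂ)) (hU : (U : Set (ℂ × ℂ)).Nonempty)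
    (r p q : ℕ) (hr : 2 ≤ r) :
    -- the distinguished complement is a complement of the kernel
    (Disjoint (complement U r p q) (kerRestrict U r p q) ∧
      complement U r p q ⊔ kerRestrict U r p q = preserving U r p q) ∧
    -- low order: polynomials in the generators
    (∀ k : ℕ, k ≤ q → r * k ≤ p → ∀ T ∈ complementDown U r p q, T ∈ opsOfOrderLE U k →
      ∃ P : MvPolynomial (Fin (r + 5)) ℂ, P.totalDegree ≤ k ∧
        ((∀ m < k, T ∉ opsOfOrderLE U m) → P.totalDegree = k) ∧
        evalGen U r p P = T) ∧
    -- arbitrary order: projections of polynomials in the generators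
    (∀ k : ℕ, ∀ T ∈ complementDown U r p q, T ∈ opsOfOrderLE U k →
      ∃ P : MvPolynomial (Fin (r + 5)) ℂ, P.totalDegree ≤ k ∧
        ((∀ m < k, T ∉ opsOfOrderLE U m) → P.totalDegree = k) ∧
        IsProjection U r p q (evalGen U r p P) T) ∧
    -- operators that are not of nonpositive `y`-degree
    (∀ T ∈ complement U r p q, T ∉ complementDown U r p q → ¬ IsLieAlgebraic U r p q T) ∧
    (∀ T ∈ complement U r p q, T ≠ 0 → ∀ a b : ℤ, 0 < b → HasBidegree T a b →
      ¬ IsLieAlgebraic U r p q T) ∧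
    -- the example `y ∂_x²`
    (r = 2 → 2 ≤ p → q = p / 2 →
      mulOp (Y U) * Dx U ^ 2 ∈ complement U r p q ∧
      HasBidegree (mulOp (Y U) * Dx U ^ 2) (-2) 1 ∧
      ¬ IsLieAlgebraic U r p q (mulOp (Y U) * Dx U ^ 2)) := by
  obtain ⟨hsplit, hlow, hproj, hdown, hbidegree, hexample⟩ := mainTheorem4_general U hU r p q
  refine ⟨hsplit, fun k hkq hrk => hlow k ((Nat.le_mul_of_pos_left k (by omega)).trans hrk) hkq hrk,
    hproj, hdown, hbidegree, ?_⟩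
  rintro rfl hp rfl
  exact hexample hp (by omega)
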